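/- **Model.** Fix $n\ge 1$ and let $\mathbb R^{n\times n}$ carry the Frobenius inner product and norm. For every $\epsilon\in(0,1)$ consider an $n\times n$ input-queued switch in discrete time: $q(t),a(t)\in\mathbb Z_{\ge0}^{n\times n}$ are the queue lengths and arrivals in slot $t$, the schedule $s(t)$ is an $n\times n$ permutation matrix chosen by a (possibly randomized) scheduling algorithm, and $q_{ij}(t+1)=\max(0,\,q_{ij}(t)+a_{ij}(t)-s_{ij}(t))$. Let $\tilde{\mathcal H}_t=(q(0),s(0),\dots,q(t),s(t))$. *Arrivals.* For each $(i,j)$ the $a_{ij}(t)$, $t\ge0$, are i.i.d.; in each slot $a_{ij}(t)$ and $a_{i'j'}(t)$ are independent for $(i,j)\ne(i',j')$; $a(t)$ is independent of $\tilde{\mathcal H}_t$; $a_{ij}(t)\le a_{\max}$ with $a_{\max}$ independent of $\epsilon$; and $\mathbb P(a(t)=0)>0$. The mean is $\mathbb E[a(t)]=\lambda=(1-\epsilon)\nu$, where $\nu$ is a fixed doubly stochastic matrix with all entries positive, and the variances satisfy $\operatorname{Var}(a_{ij}(t))\to\tilde\sigma_{ij}^2$ as $\epsilon\downarrow0$.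 *Markov chain.* The switch is described by a time-homogeneous Markov chain $X(t)$ on a countable state space. Conditions: (A.1) $X(t)$ is $\sigma(\tilde{\mathcal H}_t)$-measurable, and the chain is irreducible and aperiodic; (A.2) $q(t)=g(X(t))$ for a function $g$ under which preimages of finite sets are finite. The switch is *stable* if $X(t)$ is positive recurrent. $\bar q$ denotes the limit in distribution of $q(t)$ as $t\to\infty$. *Cone.* $\mathcal K=\{x\in\mathbb R_{+}^{n\times n}: x_{ij}=w_i+\tilde w_j \text{ for some } w,\tilde w\in\mathbb R^n\}$, and $x_{\perp\mathcal K}=x-x_{\|\mathcal K}$, where $x_{\|\mathcal K}$ is the point of $\mathcal K$ nearest to $x$. *Class.* The algorithm lies in $\Pi_1(\nu)$ if (A.1) and (A.2) hold for every $\epsilon\in(0,1)$ and there is $W_1>0$, independent of $\epsilon$, such that for all $t\ge 0$ and all states $x$ with $\mathbb P(X(t)=x)>0$, with $q=g(x)$, $$\mathbb E[\langle q(t),s(t)\rangle\mid X(t)=x]\ \ge\ \langle q,\nu\rangle+W_1\|q_{\perp\mathcal K}\|.$$ **Theorem.** Suppose that the algorithm lies in $\Pi_1(\nu)$. Then it achieves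 state-space collapse: for every $\epsilon\in(0,1)$ the switch is stable (and (A.1), (A.2) hold), and there are $\epsilon_0>0$ and constants $C_r<\infty$, $r=1,2,\dots$, independent of $\epsilon$, such that for all $0<\epsilon\le\epsilon_0$ with $\epsilon<1$ the limit $\bar q$ exists and $$\mathbb E\big[\|\bar q_{\perp\mathcal K}\|^r\big]\le C_r\qquad\text{for all } r\in\{1,2,\dots\}.$$ Moreover its heavy-traffic behaviour is MaxWeight-like: for every $\epsilon\in(0,1)$ the limit $\bar q$ exists, $\mathbb E[\sum_{ij}\bar q_{ij}]<\infty$, and $$\lim_{\epsilon\downarrow0}\ \epsilon\,\mathbb E\Big[\sum_{ij}\bar q_{ij}\Big]=\Big(1-\frac1{2n}\Big)\|\tilde\sigma\|^2,\qquad \|\tilde\sigma\|^2=\sum_{ij}\tilde\sigma_{ij}^2 .$$ -/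

import Mathlib

open MeasureTheory ProbabilityTheory Filter Topology

universe u v

noncomputable section

namespace Switch

/-! ### Geometry of `ℝ^{n × n}` with the Frobenius inner product -/

/-- `ℝ^{n × n}` with the Frobenius inner product and norm. -/
abbrev Vec (n : ℕ) : Type := EuclideanSpace ℝ (Fin n × Fin n)

/-- Matrices of natural numbers (queue lengths, arrivals, schedules). -/
abbrev NMat (n : ℕ) : Type := Fin n → Fin n → ℕ

/-- A real matrix as a vector of `ℝ^{n × n}`. -/
def vec {n : ℕ} (M : Fin n → Fin n → ℝ) : Vec n := WithLp.toLp 2 fun p => M p.1 p.2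

/-- A matrix of natural numbers as a vector of `ℝ^{n × n}`. -/
def natVec {n : ℕ} (M : NMat n) : Vec n := vec fun i j => (M i j : ℝ)

/-- The subspace `𝒮`: linear combinations `∑ᵢ wᵢ eⁱ + ∑ⱼ w̃ⱼ ẽʲ`, where `eⁱ` is the indicator of
row `i` and `ẽʲ` the indicator of column `j`; its `(i, j)` entry is `wᵢ + w̃ⱼ`. -/
def spaceS (n : ℕ) : Submodule ℝ (Vec n) where
  carrier := {x | ∃ w w' : Fin n → ℝ, ∀ i j, x (i, j) = w i + w' j}
  add_mem' := by
    rintro x y ⟨w, w', hx⟩ ⟨v, v', hy⟩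
    refine ⟨w + v, w' + v', fun i j => ?_⟩
    simp only [PiLp.add_apply, hx, hy, Pi.add_apply]
    ring
  zero_mem' := ⟨0, 0, fun i j => by simp⟩
  smul_mem' := by
    rintro c x ⟨w, w', hx⟩
    refine ⟨c • w, c • w', fun i j => ?_⟩
    simp only [PiLp.smul_apply, hx, Pi.smul_apply, smul_eq_mul]
    ring

/-- The cone `𝒦 = 𝒮 ∩ ℝ₊^{n × n}`. -/
def coneK (n : ℕ) : Set (Vec n) := {x | x ∈ spaceS n ∧ ∀ p, 0 ≤ x p}

theorem isClosed_coneK (n : ℕ) : IsClosed (coneK n) := by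
  have h1 : IsClosed ((spaceS n : Submodule ℝ (Vec n)) : Set (Vec n)) :=
    Submodule.closed_of_finiteDimensional _
  have h2 : IsClosed {x : Vec n | ∀ p, 0 ≤ x p} := by
    simp only [Set.ofPred_forall]
    exact isClosed_iInter fun p => isClosed_le continuous_const (by fun_prop)
  exact h1.inter h2

theorem exists_projK {n : ℕ} (x : Vec n) :
    ∃ y, y ∈ coneK n ∧ ∀ z ∈ coneK n, ‖x - y‖ ≤ ‖x - z‖ := by
  have hne : (coneK n).Nonempty := ⟨0, (spaceS n).zero_mem, fun p => by simp⟩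
  obtain ⟨y, hy, hxy⟩ := (isClosed_coneK n).exists_infDist_eq_dist hne x
  refine ⟨y, hy, fun z hz => ?_⟩
  rw [← dist_eq_norm, ← dist_eq_norm, ← hxy]
  exact Metric.infDist_le_dist_of_mem hz

/-- The projection `x_{∥𝒦}` of `x` onto the cone: the (unique) nearest point of `𝒦`. -/
def projK {n : ℕ} (x : Vec n) : Vec n := (exists_projK x).choose

/-- `x_{⊥𝒦} = x - x_{∥𝒦}`. -/
def perpK {n : ℕ} (x : Vec n) : Vec n := x - projK x

/-- A schedule is a permutation matrix (a perfect matching of inputs with outputs). -/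
def IsSchedule {n : ℕ} (m : NMat n) : Prop :=
  ∃ τ : Equiv.Perm (Fin n), ∀ i j, m i j = if τ i = j then 1 else 0

/-! ### Transition probabilities on a countable state space -/

/-- The `k`-step transition probabilities of the transition matrix `P`. -/
def stepDist {A : Type v} (P : A → PMF A) : ℕ → A → PMF A
  | 0, x => PMF.pure x
  | k + 1, x => (P x).bind (stepDist P k)

/-- Every state can be reached from every state. -/
def Irreducible {A : Type v} (P : A → PMF A) : Prop :=
  ∀ x y, ∃ k, stepDist P k x y ≠ 0

/-- For every state, the only common divisor of its possible return times is `1`. -/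
def Aperiodic {A : Type v} (P : A → PMF A) : Prop :=
  ∀ x, ∀ d : ℕ, (∀ k, 1 ≤ k → stepDist P k x x ≠ 0 → d ∣ k) → d = 1

open Classical in
/-- `avoidProb P x k y` is the probability that the chain started in `y` is not in `x` at any of
the times `1, …, k`. -/
def avoidProb {A : Type v} (P : A → PMF A) (x : A) : ℕ → A → ENNReal
  | 0, _ => 1
  | k + 1, y => ∑' z, if z = x then 0 else P y z * avoidProb P x k z

/-- The mean return time `𝔼ₓ[τₓ] = ∑_{k ≥ 0} ℙₓ(τₓ > k)` to the state `x`, where `τₓ` is the first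
time `t ≥ 1` at which the chain is in `x` (infinite if `τₓ = ∞` with positive probability). -/
def meanReturnTime {A : Type v} (P : A → PMF A) (x : A) : ENNReal := ∑' k, avoidProb P x k x

/-- All mean return times are finite. -/
def PositiveRecurrent {A : Type v} (P : A → PMF A) : Prop := ∀ x, meanReturnTime P x < ⊤

/-! ### The switch -/

/-- The `σ`-algebra generated by `q(0), s(0), …, q(t), s(t)`. -/
abbrev historySigma {Ω : Type u} {n : ℕ} (q s : ℕ → Ω → NMat n) (t : ℕ) : MeasurableSpace Ω :=
  ⨆ k ∈ Set.Iic t, (MeasurableSpace.comap (q k) inferInstance ⊔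
    MeasurableSpace.comap (s k) inferInstance)

/-- An `n × n` input-queued switch run by some (possibly randomized) scheduling algorithm,
together with a Markov chain describing it. -/
structure SwitchSystem (n : ℕ) where
  /-- the probability space -/
  Ω : Type u
  [mΩ : MeasurableSpace Ω]
  μ : Measure Ω
  [isProb : IsProbabilityMeasure μ]
  /-- arrivals `a(t)`, schedules `s(t)` and queue lengths `q(t)` -/
  a : ℕ → Ω → NMat n
  s : ℕ → Ω → NMat n
  q : ℕ → Ω → NMat n
  measurable_a : ∀ t, Measurable (a t)
  measurable_s : ∀ t, Measurable (s t)
  measurable_q : ∀ t, Measurable (q t)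
  isSchedule_s : ∀ t ω, IsSchedule (s t ω)
  /-- `q(t+1) = [q(t) + a(t) - s(t)]⁺`; the subtraction of natural numbers is truncated at `0`. -/
  queue_eq : ∀ t ω i j, q (t + 1) ω i j = q t ω i j + a t ω i j - s t ω i j
  /-- The algorithm does not anticipate: the arrivals of slot `t` are independent of the queue
  lengths and schedules up to and including slot `t`. -/
  nonanticipating : ∀ t, Indep (MeasurableSpace.comap (a t) inferInstance) (historySigma q s t) μ
  /-- the countable state space of the Markov chain `X(t)`, and its transition matrix -/
  A : Type v
  [countA : Countable A]
  X : ℕ → Ω → A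
  P : A → PMF A
  measurableSet_X : ∀ t x, MeasurableSet {ω | X t ω = x}
  markov : ∀ (t : ℕ) (x : ℕ → A),
    μ {ω | ∀ k ≤ t + 1, X k ω = x k} = μ {ω | ∀ k ≤ t, X k ω = x k} * P (x t) (x (t + 1))
  /-- the function that reads the queue lengths off the state of the chain -/
  g : A → NMat n

attribute [instance] SwitchSystem.mΩ SwitchSystem.isProb SwitchSystem.countA

namespace SwitchSystem

variable {n : ℕ}

/-- Assumption on the arrivals, with the bound `aMax` on the arrivals in one slot. -/
structure ArrivalAssumption (S : SwitchSystem.{u, v} n) (aMax : ℕ) : Prop where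
  indep_time : ∀ i j, iIndepFun (fun t ω => S.a t ω i j) S.μ
  ident : ∀ i j t, IdentDistrib (fun ω => S.a t ω i j) (fun ω => S.a 0 ω i j) S.μ S.μ
  indep_pairs : ∀ t i j i' j', (i, j) ≠ (i', j') →
    IndepFun (fun ω => S.a t ω i j) (fun ω => S.a t ω i' j') S.μ
  bounded : ∀ t ω i j, S.a t ω i j ≤ aMax
  noArrival : ∀ t, 0 < S.μ {ω | ∀ i j, S.a t ω i j = 0}

/-- The mean arrival rates `λᵢⱼ` (the same in all time slots). -/
def rate (S : SwitchSystem.{u, v} n) (i j : Fin n) : ℝ := ∫ ω, (S.a 0 ω i j : ℝ) ∂S.μ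

/-- The variances `σᵢⱼ²` of the arrivals (the same in all time slots). -/
def arrivalVar (S : SwitchSystem.{u, v} n) (i j : Fin n) : ℝ :=
  variance (fun ω => (S.a 0 ω i j : ℝ)) S.μ

/-- Condition A.1: `X(t)` is a function of the history up to `q(t), s(t)`, and the chain is
irreducible and aperiodic. -/
def CondA1 (S : SwitchSystem.{u, v} n) : Prop :=
  (∀ t x, MeasurableSet[historySigma S.q S.s t] {ω | S.X t ω = x}) ∧
    Irreducible S.P ∧ Aperiodic S.P

/-- Condition A.2: `q(t) = g(X(t))`, and preimages of finite sets under `g` are finite. -/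
def CondA2 (S : SwitchSystem.{u, v} n) : Prop :=
  (∀ t ω, S.q t ω = S.g (S.X t ω)) ∧ ∀ B : Set (NMat n), B.Finite → (S.g ⁻¹' B).Finite

/-- The switch is stable if its Markov chain is positive recurrent. -/
def Stable (S : SwitchSystem.{u, v} n) : Prop := PositiveRecurrent S.P

/-- `ρ` is the steady-state law, that is the law of the limit in distribution `q̄` of `q(t)`. -/
def IsSteadyState (S : SwitchSystem.{u, v} n) (ρ : ProbabilityMeasure (NMat n)) : Prop :=
  TendstoInDistribution S.q atTop id (fun _ => S.μ) (ρ : Measure (NMat n))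

end SwitchSystem

/-! ### Heavy traffic: a family of switches indexed by `ε ∈ (0, 1)`

The values of the family outside `(0, 1)` play no role. -/

/-- Mean arrival rates `(1 - ε) ν` with `ν` doubly stochastic and positive, and variances that
converge to `σ̃²` as `ε ↓ 0`. -/
structure HeavyTraffic {n : ℕ} (S : ℝ → SwitchSystem.{u, v} n) (ν : Matrix (Fin n) (Fin n) ℝ)
    (σt : Fin n → Fin n → ℝ) : Prop where
  doublyStoch : ν ∈ doublyStochastic ℝ (Fin n)
  pos : ∀ i j, 0 < ν i j
  rate_eq : ∀ ε ∈ Set.Ioo (0 : ℝ) 1, ∀ i j, (S ε).rate i j = (1 - ε) * ν i j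
  tendsto_var : ∀ i j, Tendsto (fun ε => (S ε).arrivalVar i j) (𝓝[>] 0) (𝓝 (σt i j ^ 2))

/-- The class `Π₁(ν)`: conditions A.1 and A.2 hold, and
`𝔼[⟨q(t), s(t)⟩ | X(t) = x] ≥ ⟨q, ν⟩ + W₁ ‖q_{⊥𝒦}‖` with `q = g(x)`, where `W₁ > 0` does not depend
on `ε` (for all `t` and all `x` for which the event `X(t) = x` has positive probability). -/
def InClassOne {n : ℕ} (S : ℝ → SwitchSystem.{u, v} n) (ν : Matrix (Fin n) (Fin n) ℝ) : Prop :=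
  (∀ ε ∈ Set.Ioo (0 : ℝ) 1, (S ε).CondA1 ∧ (S ε).CondA2) ∧
  ∃ W₁ : ℝ, 0 < W₁ ∧ ∀ ε ∈ Set.Ioo (0 : ℝ) 1, ∀ (t : ℕ) (x : (S ε).A),
    (S ε).μ {ω | (S ε).X t ω = x} ≠ 0 →
      inner ℝ (natVec ((S ε).g x)) (vec ν) + W₁ * ‖perpK (natVec ((S ε).g x))‖ ≤
        ∫ ω, inner ℝ (natVec ((S ε).q t ω)) (natVec ((S ε).s t ω))
          ∂(ProbabilityTheory.cond (S ε).μ {ω | (S ε).X t ω = x})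

/-- State-space collapse: stability, A.1, A.2, and all moments of `‖q̄_{⊥𝒦}‖` are bounded uniformly
in `ε ∈ (0, ε₀]`. -/
def AchievesSSC {n : ℕ} (S : ℝ → SwitchSystem.{u, v} n) : Prop :=
  (∀ ε ∈ Set.Ioo (0 : ℝ) 1, (S ε).Stable ∧ (S ε).CondA1 ∧ (S ε).CondA2) ∧
  ∃ ε₀ : ℝ, 0 < ε₀ ∧ ∃ C : ℕ → ℝ, ∀ ε ∈ Set.Ioo (0 : ℝ) 1, ε ≤ ε₀ →
    ∃ ρ : ProbabilityMeasure (NMat n), (S ε).IsSteadyState ρ ∧ ∀ r : ℕ, 1 ≤ r →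
      Integrable (fun m => ‖perpK (natVec m)‖ ^ r) (ρ : Measure (NMat n)) ∧
      ∫ m, ‖perpK (natVec m)‖ ^ r ∂(ρ : Measure (NMat n)) ≤ C r

/-- MaxWeight-like behaviour: the steady state exists with finite mean total queue length, and
`lim_{ε ↓ 0} ε 𝔼[∑ᵢⱼ q̄ᵢⱼ] = (1 - 1/(2n)) ‖σ̃‖²`. -/
def MaxWeightLike {n : ℕ} (S : ℝ → SwitchSystem.{u, v} n) (σt : Fin n → Fin n → ℝ) : Prop :=
  ∃ ρ : ℝ → ProbabilityMeasure (NMat n),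
    (∀ ε ∈ Set.Ioo (0 : ℝ) 1, (S ε).IsSteadyState (ρ ε) ∧
      Integrable (fun m : NMat n => ∑ i, ∑ j, (m i j : ℝ)) (ρ ε : Measure (NMat n))) ∧
    Tendsto (fun ε : ℝ => ε * ∫ m : NMat n, ∑ i, ∑ j, (m i j : ℝ) ∂(ρ ε : Measure (NMat n)))
      (𝓝[>] 0) (𝓝 ((1 - 1 / (2 * (n : ℝ))) * ‖vec σt‖ ^ 2))

end Switch

end

/-!
The drift of `‖q‖²` is linear in `-‖q‖` with a slope of order `ε`, and that of `‖q_{⊥𝒦}‖²` is linear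
in `-‖q_{⊥𝒦}‖` with a slope that does not depend on `ε`. Since the increments are bounded, both
`exp (θ ‖q‖)` and `exp (θ ‖q_{⊥𝒦}‖)` decrease geometrically up to a constant. The first makes the
chain positive recurrent and, by a coupling of two independent copies, convergent; the second bounds
the stationary moments of `‖q_{⊥𝒦}‖` uniformly in `ε`.

In steady state the drift of `‖P q‖²` vanishes, where `P` is the projection onto `𝒮`. As all row and
column sums of `ν - s` vanish, its main terms are `2 (ε / n) ∑ᵢⱼ qᵢⱼ` and `𝔼 ‖P (a - ν)‖²`, which
tends to `(2 n - 1) / n² ‖σ̃‖²`. The remaining terms involve the unused service `u`, whose entries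
have the mean sum `ε n`. Because `u` is orthogonal to the new queue lengths `q'`, the cross term
`⟨P q', u⟩` is at most `‖q'_{⊥𝒦}‖ ‖u‖`, which is of order `√ε` in the mean.
-/

noncomputable section

namespace Switch

/-! ### Iterated transition probabilities -/

section Chain

variable {A : Type v} (P : A → PMF A)

theorem stepDist_add (k l : ℕ) (x : A) :
    stepDist P (k + l) x = (stepDist P k x).bind (stepDist P l) := by
  induction k generalizing x with
  | zero => simp [stepDist]
  | succ k ih =>
    rw [Nat.add_right_comm]
    simp only [stepDist, PMF.bind_bind]
    exact congrArg _ (funext ih)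

theorem stepDist_one : stepDist P 1 = P := by
  funext x
  exact PMF.bind_pure _

theorem stepDist_succ' (k : ℕ) (x : A) : stepDist P (k + 1) x = (stepDist P k x).bind P := by
  rw [stepDist_add, stepDist_one]

variable {P} in
theorem stepDist_add_ne_zero {k l : ℕ} {x y z : A}
    (hxy : stepDist P k x y ≠ 0) (hyz : stepDist P l y z ≠ 0) : stepDist P (k + l) x z ≠ 0 := by
  rw [stepDist_add, PMF.bind_apply]
  exact fun h => mul_ne_zero hxy hyz (ENNReal.tsum_eq_zero.1 h y)

theorem tsum_bind_mul {B : Type*} (p : PMF A) (Q : A → PMF B) (f : B → ENNReal) :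
    ∑' y, p.bind Q y * f y = ∑' w, p w * ∑' y, Q w y * f y := by
  simp only [PMF.bind_apply, ← ENNReal.tsum_mul_right, ← ENNReal.tsum_mul_left]
  rw [ENNReal.tsum_comm]
  simp only [mul_assoc]

/-- The expectation of `f` after `k` steps of the chain started in `x`. -/
def stepExp (k : ℕ) (f : A → ENNReal) (x : A) : ENNReal :=
  ∑' y, stepDist P k x y * f y

theorem stepExp_zero (f : A → ENNReal) (x : A) : stepExp P 0 f x = f x := by
  classical
  rw [stepExp, tsum_eq_single x fun y hy => by simp [stepDist, hy]]
  simp [stepDist]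

theorem stepExp_succ (k : ℕ) (f : A → ENNReal) (x : A) :
    stepExp P (k + 1) f x = ∑' w, P x w * stepExp P k f w :=
  tsum_bind_mul (P x) (stepDist P k) f

theorem stepExp_succ' (k : ℕ) (f : A → ENNReal) (x : A) :
    stepExp P (k + 1) f x = stepExp P k (fun w => ∑' y, P w y * f y) x := by
  simp only [stepExp, stepDist_succ']
  exact tsum_bind_mul _ _ _

theorem stepExp_mono (k : ℕ) {f h : A → ENNReal} (hfh : ∀ y, f y ≤ h y) (x : A) :
    stepExp P k f x ≤ stepExp P k h x :=
  ENNReal.tsum_le_tsum fun y => mul_le_mul_right (hfh y) _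

theorem stepExp_const_mul_add (k : ℕ) (f : A → ENNReal) (c d : ENNReal) (x : A) :
    stepExp P k (fun y => c * f y + d) x = c * stepExp P k f x + d := by
  simp only [stepExp, mul_add]
  rw [ENNReal.tsum_add, ENNReal.tsum_mul_right, PMF.tsum_coe, one_mul, ← ENNReal.tsum_mul_left]
  simp only [mul_left_comm]

open Classical in
theorem stepExp_single (k : ℕ) (x y : A) : stepExp P k (Pi.single y 1) x = stepDist P k x y := by
  rw [stepExp, tsum_eq_single y fun w hw => by simp [hw]]
  simp

/-- Every finite set of states reaches `z` with positive probability in a common positive number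
of steps. -/
def UniformlyReaches (z : A) : Prop :=
  ∀ F : Set A, F.Finite → ∃ m, ∀ y ∈ F, stepDist P (m + 1) y z ≠ 0

variable {P}

theorem Aperiodic.eventually_stepDist_self_ne_zero (hap : Aperiodic P) (z : A) :
    ∀ᶠ k in atTop, stepDist P k z z ≠ 0 := by
  let returnTimes : AddSubmonoid ℕ :=
    { carrier := {k | stepDist P k z z ≠ 0}
      add_mem' := fun h₁ h₂ => stepDist_add_ne_zero h₁ h₂
      zero_mem' := by simp [stepDist] }
  have hgcd : Nat.setGcd (returnTimes : Set ℕ) = 1 :=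
    hap z _ fun k _ hk => Nat.setGcd_dvd_of_mem (s := (returnTimes : Set ℕ)) hk
  obtain ⟨N, hN⟩ := Nat.exists_mem_closure_of_ge (returnTimes : Set ℕ)
  filter_upwards [eventually_ge_atTop N] with k hk
  have hmem := hN k hk (by simp [hgcd])
  rwa [AddSubmonoid.closure_eq] at hmem

theorem Irreducible.uniformlyReaches (hirr : Irreducible P) (hap : Aperiodic P) (z : A) :
    UniformlyReaches P z := by
  intro F hF
  obtain ⟨N, hN⟩ := eventually_atTop.1 (hap.eventually_stepDist_self_ne_zero z)
  choose κ hκ using fun y => hirr y z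
  obtain ⟨M, hM⟩ := (hF.image κ).bddAbove
  refine ⟨M + N, fun y hy => ?_⟩
  have hle : κ y ≤ M := hM ⟨y, hy, rfl⟩
  have hreach := stepDist_add_ne_zero (hκ y) (hN (M + N + 1 - κ y) (by lia))
  rwa [Nat.add_sub_cancel' (by lia)] at hreach

/-- The Foster–Lyapunov condition for geometric ergodicity, for a Lyapunov function `V` whose
sublevel sets need not be finite. -/
structure GeometricDrift (P : A → PMF A) (V : A → NNReal) (γ K : NNReal) : Prop where
  lt_one : γ < 1
  tsum_le : ∀ x, ∑' y, P x y * (V y : ENNReal) ≤ γ * V x + K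

namespace GeometricDrift

variable {V : A → NNReal} {γ K : NNReal}

theorem mul_div_add (h : GeometricDrift P V γ K) : γ * (K / (1 - γ)) + K = K / (1 - γ) := by
  have hne : 1 - γ ≠ 0 := (tsub_pos_of_lt h.lt_one).ne'
  calc γ * (K / (1 - γ)) + K = (γ + (1 - γ)) * (K / (1 - γ)) := by
        rw [add_mul, mul_div_cancel₀ _ hne]
    _ = K / (1 - γ) := by rw [add_tsub_cancel_of_le h.lt_one.le, one_mul]

theorem stepExp_le (h : GeometricDrift P V γ K) (k : ℕ) (x : A) :
    stepExp P k (fun y => (V y : ENNReal)) x ≤ γ ^ k * V x + (K / (1 - γ) : NNReal) := by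
  induction k with
  | zero => simp [stepExp_zero]
  | succ k ih =>
    calc stepExp P (k + 1) (fun y => (V y : ENNReal)) x
        ≤ stepExp P k (fun y => γ * V y + K) x := by
          rw [stepExp_succ']; exact stepExp_mono P k h.tsum_le x
      _ = γ * stepExp P k (fun y => (V y : ENNReal)) x + K := stepExp_const_mul_add ..
      _ ≤ γ * (γ ^ k * V x + (K / (1 - γ) : NNReal)) + K := by gcongr
      _ = γ ^ (k + 1) * V x + (γ * (K / (1 - γ)) + K : NNReal) := by push_cast; ring
      _ = γ ^ (k + 1) * V x + (K / (1 - γ) : NNReal) := by rw [h.mul_div_add]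

theorem stepExp_le_add (h : GeometricDrift P V γ K) (k : ℕ) (x : A) :
    stepExp P k (fun y => (V y : ENNReal)) x ≤ (V x + K / (1 - γ) : NNReal) := by
  refine (h.stepExp_le k x).trans ?_
  push_cast
  gcongr
  exact mul_le_of_le_one_left' (by exact_mod_cast pow_le_one' h.lt_one.le k)

end GeometricDrift

/-! ### Avoiding a state -/

variable (P)

theorem avoidProb_le_one (z : A) (k : ℕ) (y : A) : avoidProb P z k y ≤ 1 := by
  induction k generalizing y with
  | zero => simp [avoidProb]
  | succ k ih =>
    rw [avoidProb, ← (P y).tsum_coe]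
    refine ENNReal.tsum_le_tsum fun w => ?_
    split_ifs
    · simp
    · exact mul_le_of_le_one_right' (ih w)

theorem avoidProb_antitone (z y : A) : Antitone fun k => avoidProb P z k y := by
  refine antitone_nat_of_succ_le fun k => ?_
  induction k generalizing y with
  | zero => exact avoidProb_le_one P z 1 y
  | succ k ih =>
    rw [avoidProb]
    conv_rhs => rw [avoidProb]
    refine ENNReal.tsum_le_tsum fun w => ?_
    split_ifs
    · exact le_rfl
    · exact mul_le_mul_right (ih w) _

theorem avoidProb_add_le_stepExp (z : A) (k : ℕ) {f : A → ENNReal}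
    (hf : ∀ y, avoidProb P z k y ≤ f y) (m : ℕ) (y : A) :
    avoidProb P z (m + 1 + k) y + stepDist P (m + 1) y z * f z ≤ stepExp P (m + 1) f y := by
  classical
  induction m generalizing y with
  | zero =>
    rw [show 0 + 1 + k = k + 1 by ring, avoidProb, zero_add, stepExp, stepDist_one,
      ENNReal.tsum_eq_add_tsum_ite (f := fun w => P y w * f w) z, add_comm]
    gcongr with w
    split_ifs
    · exact le_rfl
    · exact mul_le_mul_right (hf w) _
  | succ m ih =>
    rw [show m + 1 + 1 + k = (m + 1 + k) + 1 by ring, avoidProb, stepExp_succ, stepDist,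
      PMF.bind_apply, ← ENNReal.tsum_mul_right, ← ENNReal.tsum_add]
    refine ENNReal.tsum_le_tsum fun w => ?_
    calc _ ≤ P y w * avoidProb P z (m + 1 + k) w + P y w * stepDist P (m + 1) w z * f z := by
          gcongr
          split_ifs
          · exact zero_le
          · exact le_rfl
      _ = P y w * (avoidProb P z (m + 1 + k) w + stepDist P (m + 1) w z * f z) := by ring
      _ ≤ _ := mul_le_mul_right (ih w) _

variable {P}

theorem avoidProb_mul_le_pow_mul {z : A} {W : A → ENNReal} {ρ : ENNReal} {m : ℕ}
    (hW : ∀ y, 1 ≤ W y)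
    (hcontr : ∀ y, stepExp P (m + 1) W y ≤ ρ * W y + stepDist P (m + 1) y z) (hρ : ρ ≠ ⊤)
    (j : ℕ) (y : A) : avoidProb P z (j * (m + 1)) y ≤ ρ ^ j * W y := by
  induction j generalizing y with
  | zero => simpa [avoidProb] using hW y
  | succ j ih =>
    set hit := stepDist P (m + 1) y z
    have hround : avoidProb P z (m + 1 + j * (m + 1)) y + ρ ^ j * hit ≤
        ρ ^ (j + 1) * W y + ρ ^ j * hit :=
      calc _ ≤ avoidProb P z (m + 1 + j * (m + 1)) y + hit * (ρ ^ j * W z) := by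
            rw [mul_comm hit, mul_assoc]
            gcongr
            exact le_mul_of_one_le_left zero_le (hW z)
        _ ≤ stepExp P (m + 1) (fun w => ρ ^ j * W w + 0) y := by
            simpa only [add_zero] using avoidProb_add_le_stepExp P z (j * (m + 1)) ih m y
        _ = ρ ^ j * stepExp P (m + 1) W y := by rw [stepExp_const_mul_add, add_zero]
        _ ≤ ρ ^ j * (ρ * W y + hit) := mul_le_mul_right (hcontr y) _
        _ = ρ ^ (j + 1) * W y + ρ ^ j * hit := by ring
    rw [show (j + 1) * (m + 1) = m + 1 + j * (m + 1) by ring]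
    exact ENNReal.le_of_add_le_add_right
      (ENNReal.mul_ne_top (ENNReal.pow_ne_top hρ) (PMF.apply_ne_top _ _)) hround

theorem exists_pos_forall_le {F : Set A} (hF : F.Finite) {f : A → ENNReal}
    (hf : ∀ y ∈ F, f y ≠ 0) : ∃ α : NNReal, 0 < α ∧ α ≤ 1 ∧ ∀ y ∈ F, α ≤ f y := by
  have hpos : 0 < min 1 (hF.toFinset.inf f) := lt_min one_pos <|
    (Finset.lt_inf_iff ENNReal.zero_lt_top).2 fun y hy =>
      pos_iff_ne_zero.2 (hf y (by simpa using hy))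
  obtain ⟨α, hα, hαmin⟩ := ENNReal.lt_iff_exists_nnreal_btwn.1 hpos
  refine ⟨α, by exact_mod_cast hα, by exact_mod_cast hαmin.le.trans (min_le_left _ _), ?_⟩
  exact fun y hy => hαmin.le.trans ((min_le_right _ _).trans (Finset.inf_le (by simpa using hy)))

/-- With `p` the probability of hitting the target within one round, the weight `β v + 1` shrinks
by the factor `ρ`: the drift does it when `v > R`, and `p ≥ α` does it when `v ≤ R`. -/
theorem exists_contraction_constants {γ K α R : NNReal} (hγ : γ < 1) (hα : 0 < α) (hα₁ : α ≤ 1)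
    (hR : 2 * (K + 1) / (1 - γ) ≤ R) :
    ∃ β ρ : NNReal, β ≤ 1 ∧ ρ < 1 ∧ ∀ v p : NNReal, (v ≤ R → α ≤ p) →
      β * (γ * v + K) + 1 ≤ ρ * (β * v + 1) + p := by
  have hγ' : (γ : ℝ) < 1 := hγ
  have hα' : (0 : ℝ) < α := hα
  have hα₁' : (α : ℝ) ≤ 1 := hα₁
  replace hR : 2 * ((K : ℝ) + 1) ≤ (1 - γ) * R := by
    rw [div_le_iff₀' (tsub_pos_of_lt hγ)] at hR
    simpa [NNReal.coe_sub hγ.le] using NNReal.coe_le_coe.2 hR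
  set β : NNReal := α / (2 * (R + K + 1))
  have hβ : (β : ℝ) * (2 * (R + K + 1)) = α := by
    exact_mod_cast div_mul_cancel₀ α (by positivity : 2 * (R + K + 1) ≠ 0)
  have hβ₀ : (0 : ℝ) < β := by positivity
  have hβ₁ : (β : ℝ) ≤ 1 := by nlinarith [R.coe_nonneg, K.coe_nonneg]
  obtain ⟨ρ, hρ₀, hρβ, hργ, hρα, hρ₁⟩ : ∃ ρ : ℝ, 0 ≤ ρ ∧ 1 - β ≤ ρ ∧ (1 + γ) / 2 ≤ ρ ∧
      1 - α / 2 ≤ ρ ∧ ρ < 1 :=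
    ⟨max (1 - β) (max ((1 + γ) / 2) (1 - α / 2)), le_max_of_le_left (by linarith),
      le_max_left _ _, le_max_of_le_right (le_max_left _ _), le_max_of_le_right (le_max_right _ _),
      max_lt (by linarith) (max_lt (by linarith) (by linarith))⟩
  lift ρ to NNReal using hρ₀
  refine ⟨β, ρ, hβ₁, hρ₁, fun v p hp => ?_⟩
  rw [← NNReal.coe_le_coe]
  push_cast
  have hweight : (1 + γ) / 2 * (β * v) ≤ (ρ * (β * v) : ℝ) := by gcongr
  rcases le_or_gt v R with hvR | hvR
  · have : (v : ℝ) ≤ R := hvR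
    have hαp : (α : ℝ) ≤ p := hp hvR
    have hhalf : (β * (γ * v + K) : ℝ) ≤ β * (R + K + 1) :=
      mul_le_mul_of_nonneg_left (by nlinarith [v.coe_nonneg]) hβ₀.le
    nlinarith [mul_nonneg hβ₀.le v.coe_nonneg]
  · have : (R : ℝ) < v := hvR
    have hdrift : (β * (2 * (K + 1)) : ℝ) ≤ β * ((1 - γ) * v) :=
      mul_le_mul_of_nonneg_left (by nlinarith) hβ₀.le
    nlinarith [p.coe_nonneg]

namespace GeometricDrift

variable {V : A → NNReal} {γ K : NNReal} {z : A}

theorem exists_avoidProb_mul_le (h : GeometricDrift P V γ K) (hfin : ∀ R, {x | V x ≤ R}.Finite)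
    (hreach : UniformlyReaches P z) :
    ∃ (m : ℕ) (ρ : NNReal), ρ < 1 ∧
      ∀ j y, avoidProb P z (j * (m + 1)) y ≤ (ρ : ENNReal) ^ j * (V y + 1) := by
  set L : NNReal := K / (1 - γ)
  set R : NNReal := 2 * (L + 1) / (1 - γ)
  obtain ⟨m, hm⟩ := hreach _ (hfin R)
  obtain ⟨α, hα, hα₁, hαm⟩ := exists_pos_forall_le (hfin R) hm
  obtain ⟨β, ρ, hβ, hρ, hconst⟩ := exists_contraction_constants (K := L) h.lt_one hα hα₁ le_rfl
  have hcontr (y : A) : stepExp P (m + 1) (fun w => (β * V w + 1 : ENNReal)) y ≤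
      ρ * (β * V y + 1) + stepDist P (m + 1) y z := by
    set hit := (stepDist P (m + 1) y z).toNNReal
    have hhit : (hit : ENNReal) = stepDist P (m + 1) y z :=
      ENNReal.coe_toNNReal (PMF.apply_ne_top _ _)
    calc stepExp P (m + 1) (fun w => (β * V w + 1 : ENNReal)) y
        = β * stepExp P (m + 1) (fun w => (V w : ENNReal)) y + 1 := stepExp_const_mul_add ..
      _ ≤ β * (γ ^ (m + 1) * V y + L) + 1 := by gcongr; exact h.stepExp_le (m + 1) y
      _ ≤ β * (γ * V y + L) + 1 := by
          gcongr
          exact_mod_cast pow_le_of_le_one zero_le h.lt_one.le m.succ_ne_zero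
      _ ≤ ρ * (β * V y + 1) + hit := by
          exact_mod_cast hconst (V y) hit fun hy => by exact_mod_cast hhit ▸ hαm y hy
      _ = ρ * (β * V y + 1) + stepDist P (m + 1) y z := by rw [hhit]
  refine ⟨m, ρ, hρ, fun j y => ?_⟩
  calc avoidProb P z (j * (m + 1)) y ≤ (ρ : ENNReal) ^ j * (β * V y + 1) :=
        avoidProb_mul_le_pow_mul (fun _ => le_add_self) hcontr ENNReal.coe_ne_top j y
    _ ≤ (ρ : ENNReal) ^ j * (V y + 1) := by
        gcongr
        exact mul_le_of_le_one_left' (by exact_mod_cast hβ)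

end GeometricDrift

theorem summable_pow_div {ρ : NNReal} (hρ : ρ < 1) (m : ℕ) [NeZero m] :
    Summable fun k => ρ ^ (k / m) := by
  rw [← (Nat.divModEquiv m).symm.summable_iff]
  have hgeom : Summable fun p : ℕ × Fin m => (ρ : ℝ) ^ p.1 * 1 :=
    (summable_geometric_of_lt_one ρ.coe_nonneg hρ).mul_of_nonneg (g := fun _ : Fin m => (1 : ℝ))
      (hasSum_fintype _).summable (fun _ => by positivity) (fun _ => zero_le_one)
  refine (NNReal.summable_coe.1 (by exact_mod_cast hgeom)).congr fun p => ?_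
  have hdiv : (p.1 * m + (p.2 : ℕ)) / m = p.1 := by
    rw [mul_comm, Nat.mul_add_div (NeZero.pos m), Nat.div_eq_of_lt p.2.2, add_zero]
  simp [Nat.divModEquiv, hdiv]

namespace GeometricDrift

variable {V : A → NNReal} {γ K : NNReal} {z : A}

theorem exists_summable_avoidProb_le (h : GeometricDrift P V γ K)
    (hfin : ∀ R, {x | V x ≤ R}.Finite) (hreach : UniformlyReaches P z) :
    ∃ r : ℕ → NNReal, Summable r ∧ ∀ k y, avoidProb P z k y ≤ r k * (V y + 1) := by
  obtain ⟨m, ρ, hρ, hle⟩ := h.exists_avoidProb_mul_le hfin hreach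
  refine ⟨fun k => ρ ^ (k / (m + 1)), summable_pow_div hρ (m + 1), fun k y => ?_⟩
  calc avoidProb P z k y ≤ avoidProb P z (k / (m + 1) * (m + 1)) y :=
        avoidProb_antitone P z y (Nat.div_mul_le_self k (m + 1))
    _ ≤ _ := by exact_mod_cast hle (k / (m + 1)) y

theorem positiveRecurrent (h : GeometricDrift P V γ K) (hfin : ∀ R, {x | V x ≤ R}.Finite)
    (hirr : Irreducible P) (hap : Aperiodic P) : PositiveRecurrent P := by
  intro z
  obtain ⟨r, hr, hle⟩ := h.exists_summable_avoidProb_le hfin (hirr.uniformlyReaches hap z)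
  calc meanReturnTime P z ≤ ∑' k, (r k : ENNReal) * (V z + 1) :=
        ENNReal.tsum_le_tsum fun k => hle k z
    _ = (∑' k, (r k : ENNReal)) * (V z + 1) := ENNReal.tsum_mul_right
    _ < ⊤ := ENNReal.mul_lt_top (ENNReal.tsum_coe_ne_top_iff_summable.2 hr).lt_top (by finiteness)

end GeometricDrift

end Chain

/-! ### Convergence to the stationary distribution -/

section Coupling

variable {A : Type v} (P : A → PMF A)

/-- The transition matrix of two independent copies of the chain. -/
def prodChain (p : A × A) : PMF (A × A) := (P p.1).bind fun w => (P p.2).map (Prod.mk w)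

theorem prodChain_apply (p w : A × A) : prodChain P p w = P p.1 w.1 * P p.2 w.2 := by
  classical
  obtain ⟨w₁, w₂⟩ := w
  simp only [prodChain, PMF.bind_apply, PMF.map_apply, Prod.mk.injEq]
  rw [tsum_eq_single w₁ fun y hy => by simp [hy.symm],
    tsum_eq_single w₂ fun y hy => by simp [hy.symm]]
  simp

theorem tsum_prodChain_mul_fst (p : A × A) (f : A → ENNReal) :
    ∑' w, prodChain P p w * f w.1 = ∑' w, P p.1 w * f w := by
  simp only [prodChain_apply, ENNReal.tsum_prod', mul_right_comm _ _ (f _),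
    ENNReal.tsum_mul_left, PMF.tsum_coe, mul_one]

theorem tsum_prodChain_mul_snd (p : A × A) (f : A → ENNReal) :
    ∑' w, prodChain P p w * f w.2 = ∑' w, P p.2 w * f w := by
  simp only [prodChain_apply, ENNReal.tsum_prod', mul_assoc, ENNReal.tsum_mul_left,
    ENNReal.tsum_mul_right, PMF.tsum_coe, one_mul]

theorem stepDist_prodChain (k : ℕ) (p w : A × A) :
    stepDist (prodChain P) k p w = stepDist P k p.1 w.1 * stepDist P k p.2 w.2 := by
  classical
  induction k generalizing p with
  | zero =>
    simp only [stepDist, PMF.pure_apply, Prod.ext_iff]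
    split_ifs <;> simp_all
  | succ k ih =>
    simp only [stepDist, PMF.bind_apply, ih, prodChain_apply]
    rw [ENNReal.tsum_prod', ← ENNReal.tsum_mul_right]
    refine tsum_congr fun u => ?_
    rw [← ENNReal.tsum_mul_left]
    exact tsum_congr fun u' => by ring

/-- Once the two copies have met in `z`, they have the same law. -/
theorem stepExp_le_add_avoidProb (z : A) {f : A → ENNReal} (hf : ∀ y, f y ≤ 1) (k : ℕ) (x y : A) :
    stepExp P k f x ≤ stepExp P k f y + avoidProb (prodChain P) (z, z) k (x, y) := by
  induction k generalizing x y with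
  | zero =>
    simp only [stepExp_zero, avoidProb]
    exact (hf x).trans le_add_self
  | succ k ih =>
    rw [stepExp_succ, stepExp_succ, avoidProb, ← tsum_prodChain_mul_fst P (x, y),
      ← tsum_prodChain_mul_snd P (x, y), ← ENNReal.tsum_add]
    refine ENNReal.tsum_le_tsum fun p => ?_
    split_ifs with h
    · simp [h]
    · rw [← mul_add]
      exact mul_le_mul_right (ih p.1 p.2) _

variable {P}

theorem UniformlyReaches.prodChain {z : A} (h : UniformlyReaches P z) :
    UniformlyReaches (prodChain P) (z, z) := by
  intro F hF
  obtain ⟨m, hm⟩ := h _ ((hF.image Prod.fst).union (hF.image Prod.snd))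
  refine ⟨m, fun p hp => ?_⟩
  rw [stepDist_prodChain]
  exact mul_ne_zero (hm _ (.inl ⟨p, hp, rfl⟩)) (hm _ (.inr ⟨p, hp, rfl⟩))

variable {V : A → NNReal} {γ K : NNReal}

theorem finite_sublevel_prod (hfin : ∀ R, {x | V x ≤ R}.Finite) (R : NNReal) :
    {p : A × A | V p.1 + V p.2 ≤ R}.Finite := by
  refine ((hfin R).prod (hfin R)).subset fun p (hp : V p.1 + V p.2 ≤ R) => ⟨?_, ?_⟩
  · exact le_self_add.trans hp
  · exact le_add_self.trans hp

theorem GeometricDrift.prodChain (h : GeometricDrift P V γ K) :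
    GeometricDrift (prodChain P) (fun p => V p.1 + V p.2) γ (2 * K) where
  lt_one := h.lt_one
  tsum_le p := by
    simp only [ENNReal.coe_add, ENNReal.coe_mul, mul_add]
    rw [ENNReal.tsum_add, tsum_prodChain_mul_fst P p fun w => (V w : ENNReal),
      tsum_prodChain_mul_snd P p fun w => (V w : ENNReal)]
    calc _ ≤ (γ * V p.1 + K : ENNReal) + (γ * V p.2 + K) :=
          add_le_add (h.tsum_le _) (h.tsum_le _)
      _ = _ := by push_cast; ring

theorem tsum_le_liminf_tsum {f : ℕ → A → ENNReal} {l : A → ENNReal}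
    (h : ∀ a, Tendsto (fun k => f k a) atTop (𝓝 (l a))) :
    ∑' a, l a ≤ liminf (fun k => ∑' a, f k a) atTop := by
  let _ : MeasurableSpace A := ⊤
  simp only [← lintegral_count]
  calc ∫⁻ a, l a ∂Measure.count = ∫⁻ a, liminf (fun k => f k a) atTop ∂Measure.count :=
        lintegral_congr fun a => (h a).liminf_eq.symm
    _ ≤ _ := lintegral_liminf_le fun k => measurable_from_top

theorem le_sum_add_of_le_outside (p : PMF A) {V : A → ENNReal} {R : ENNReal} {F : Finset A}
    (hF : ∀ y ∉ F, R ≤ V y) : R ≤ R * ∑ y ∈ F, p y + ∑' y, p y * V y := by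
  classical
  calc R = ∑' y, p y * R := by rw [ENNReal.tsum_mul_right, PMF.tsum_coe, one_mul]
    _ ≤ ∑' y, ((if y ∈ F then R * p y else 0) + p y * V y) := by
        refine ENNReal.tsum_le_tsum fun y => ?_
        split_ifs with hy
        · exact (mul_comm _ _).trans_le le_self_add
        · exact (mul_le_mul_right (hF y hy) _).trans le_add_self
    _ = R * ∑ y ∈ F, p y + ∑' y, p y * V y := by
        rw [ENNReal.tsum_add, tsum_eq_sum (s := F) (fun y hy => if_neg hy), Finset.mul_sum,
          Finset.sum_congr rfl fun y hy => if_pos hy]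

theorem eq_one_of_forall_le_mul_add {s M : NNReal} (hs : s ≤ 1)
    (h : ∀ R : NNReal, R ≤ R * s + M) : s = 1 := by
  by_contra hne
  have hpos : 0 < 1 - s := tsub_pos_of_lt (lt_of_le_of_ne hs hne)
  have hR := h ((M + 1) / (1 - s))
  have hsplit : (M + 1) / (1 - s) = (M + 1) / (1 - s) * s + (M + 1) := by
    nth_rewrite 3 [← div_mul_cancel₀ (M + 1) hpos.ne']
    rw [← mul_add, add_tsub_cancel_of_le hs, mul_one]
  simpa using le_of_add_le_add_left (hsplit.symm.trans_le hR)

variable (P) in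
/-- From every initial state, the law of the chain converges pointwise to `π`. -/
def IsLimitLaw (π : PMF A) : Prop :=
  ∀ x y, Tendsto (fun k => stepDist P k x y) atTop (𝓝 (π y))

namespace GeometricDrift

theorem exists_coupling_rate (h : GeometricDrift P V γ K) (hfin : ∀ R, {x | V x ≤ R}.Finite)
    {z : A} (hreach : UniformlyReaches P z) :
    ∃ r : ℕ → NNReal, Tendsto r atTop (𝓝 0) ∧ ∀ k x x' y,
      stepDist P k x y ≤ stepDist P k x' y + r k * (V x + V x' + 1) := by
  classical
  obtain ⟨r, hr, hle⟩ := h.prodChain.exists_summable_avoidProb_le (finite_sublevel_prod hfin)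
    hreach.prodChain
  refine ⟨r, NNReal.tendsto_atTop_zero_of_summable hr, fun k x x' y => ?_⟩
  have hcouple := stepExp_le_add_avoidProb P z (f := Pi.single y 1)
    (fun w => by by_cases hw : w = y <;> simp [hw]) k x x'
  rw [stepExp_single, stepExp_single] at hcouple
  exact hcouple.trans (add_le_add_right (by exact_mod_cast hle k (x, x')) _)

theorem exists_tendsto_stepDist (h : GeometricDrift P V γ K) (hfin : ∀ R, {x | V x ≤ R}.Finite)
    {z : A} (hreach : UniformlyReaches P z) :
    ∃ L : A → ENNReal, ∀ x y, Tendsto (fun k => stepDist P k x y) atTop (𝓝 (L y)) := by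
  obtain ⟨r, hr, hle⟩ := h.exists_coupling_rate hfin hreach
  have hlater (k l : ℕ) (x x' y : A) : stepDist P (l + k) x y ≤
      stepDist P k x' y + r k * (V x + K / (1 - γ) + (V x' + 1) : NNReal) :=
    calc stepDist P (l + k) x y = stepExp P l (fun w => stepDist P k w y) x := by
          rw [stepDist_add, PMF.bind_apply, stepExp]
      _ ≤ stepExp P l (fun w => r k * V w + (stepDist P k x' y + r k * (V x' + 1))) x :=
          stepExp_mono P l (fun w => (hle k w x' y).trans_eq (by ring)) x
      _ ≤ r k * (V x + K / (1 - γ) : NNReal) + (stepDist P k x' y + r k * (V x' + 1)) := by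
          rw [stepExp_const_mul_add]
          gcongr
          exact h.stepExp_le_add l x
      _ = _ := by push_cast; ring
  have hlimsup (x x' y : A) : limsup (fun k => stepDist P k x y) atTop ≤
      liminf (fun k => stepDist P k x' y) atTop := by
    have hr' : Tendsto (fun k => (r k * (V x + K / (1 - γ) + (V x' + 1) : NNReal) : ENNReal))
        atTop (𝓝 0) := by
      simpa using ENNReal.tendsto_coe.2 (hr.mul_const (V x + K / (1 - γ) + (V x' + 1)))
    rw [← ENNReal.liminf_add_of_right_tendsto_zero hr']
    refine le_liminf_of_le (by isBoundedDefault) (.of_forall fun k => ?_)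
    refine limsup_le_of_le (by isBoundedDefault) ?_
    filter_upwards [eventually_ge_atTop k] with m hm
    obtain ⟨l, rfl⟩ := Nat.exists_eq_add_of_le' hm
    exact hlater k l x x' y
  refine ⟨fun y => liminf (fun k => stepDist P k z y) atTop, fun x y => ?_⟩
  exact tendsto_of_le_liminf_of_limsup_le ((liminf_le_limsup).trans (hlimsup z x y)) (hlimsup x z y)

theorem tsum_eq_one_of_tendsto_stepDist (h : GeometricDrift P V γ K)
    (hfin : ∀ R, {x | V x ≤ R}.Finite) {z : A} {L : A → ENNReal}
    (hL : ∀ y, Tendsto (fun k => stepDist P k z y) atTop (𝓝 (L y))) : ∑' y, L y = 1 := by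
  have hle : ∑' y, L y ≤ 1 := (tsum_le_liminf_tsum hL).trans (by simp)
  obtain ⟨s, hs, hs₁⟩ := (ENNReal.le_coe_iff (r := 1)).1 hle
  have htight (R : NNReal) : (R : ENNReal) ≤ R * ∑' y, L y + (V z + K / (1 - γ) : NNReal) := by
    refine le_trans (ge_of_tendsto'
      ((ENNReal.Tendsto.const_mul (tendsto_finsetSum (hfin R).toFinset fun y _ => hL y)
        (.inr ENNReal.coe_ne_top)).add_const _) fun k => ?_)
      (add_le_add_left (mul_le_mul_right (ENNReal.sum_le_tsum (hfin R).toFinset) _) _)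
    refine (le_sum_add_of_le_outside (stepDist P k z) fun y hy => ?_).trans
      (add_le_add_right (h.stepExp_le_add k z) _)
    have hy' : ¬ V y ≤ R := by simpa using hy
    exact_mod_cast (not_le.1 hy').le
  rw [hs] at htight ⊢
  exact_mod_cast eq_one_of_forall_le_mul_add hs₁ fun R => by exact_mod_cast htight R

theorem exists_isLimitLaw [Nonempty A] (h : GeometricDrift P V γ K)
    (hfin : ∀ R, {x | V x ≤ R}.Finite) (hirr : Irreducible P) (hap : Aperiodic P) :
    ∃ π, IsLimitLaw P π := by
  obtain ⟨z⟩ := ‹Nonempty A›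
  obtain ⟨L, hL⟩ := h.exists_tendsto_stepDist hfin (hirr.uniformlyReaches hap z)
  have hsum := h.tsum_eq_one_of_tendsto_stepDist hfin (hL z)
  exact ⟨⟨L, hsum ▸ ENNReal.summable.hasSum⟩, hL⟩

end GeometricDrift

namespace IsLimitLaw

variable {π : PMF A}

theorem bind_eq (hπ : IsLimitLaw P π) : π.bind P = π := by
  obtain ⟨z, -⟩ := π.support_nonempty
  have hle (y : A) : π.bind P y ≤ π y :=
    calc π.bind P y ≤ liminf (fun k => ∑' w, stepDist P k z w * P w y) atTop :=
          tsum_le_liminf_tsum fun w =>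
            ENNReal.Tendsto.mul_const (hπ z w) (.inr (PMF.apply_ne_top _ _))
      _ = liminf (fun k => stepDist P (k + 1) z y) atTop := by
          simp only [stepDist_succ', PMF.bind_apply]
      _ = π y := ((hπ z y).comp (tendsto_add_atTop_nat 1)).liminf_eq
  ext y
  by_contra hne
  have hlt := ENNReal.tsum_lt_tsum (PMF.tsum_coe_ne_top _) hle (lt_of_le_of_ne (hle y) hne)
  simp only [PMF.tsum_coe, lt_irrefl] at hlt

theorem tsum_le_liminf_stepExp (hπ : IsLimitLaw P π) (p : PMF A) {f : A → ENNReal}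
    (hf : ∀ y, f y ≠ ⊤) :
    ∑' y, π y * f y ≤ liminf (fun k => ∑' x, p x * stepExp P k f x) atTop := by
  have hfatou := tsum_le_liminf_tsum
    (f := fun k (w : A × A) => p w.1 * (stepDist P k w.1 w.2 * f w.2))
    (l := fun w => p w.1 * (π w.2 * f w.2)) fun w =>
      ENNReal.Tendsto.const_mul (ENNReal.Tendsto.mul_const (hπ w.1 w.2) (.inr (hf _)))
        (.inr (PMF.apply_ne_top _ _))
  simpa only [ENNReal.tsum_prod', ENNReal.tsum_mul_left, ENNReal.tsum_mul_right, PMF.tsum_coe,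
    one_mul, stepExp] using hfatou

theorem tsum_le_of_geometricDrift (hπ : IsLimitLaw P π) (h : GeometricDrift P V γ K) :
    ∑' y, π y * (V y : ENNReal) ≤ (K / (1 - γ) : NNReal) := by
  obtain ⟨z, -⟩ := π.support_nonempty
  have hlim : Tendsto (fun k : ℕ => (γ : ENNReal) ^ k * V z + (K / (1 - γ) : NNReal)) atTop
      (𝓝 (K / (1 - γ) : NNReal)) := by
    simpa using (ENNReal.Tendsto.mul_const (ENNReal.tendsto_pow_atTop_nhds_zero_of_lt_one
      (r := (γ : ENNReal)) (by exact_mod_cast h.lt_one)) (b := (V z : ENNReal))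
      (.inr ENNReal.coe_ne_top)).add_const ((K / (1 - γ) : NNReal) : ENNReal)
  calc ∑' y, π y * (V y : ENNReal)
      ≤ liminf (fun k => stepExp P k (fun y => (V y : ENNReal)) z) atTop :=
        tsum_le_liminf_tsum fun w => ENNReal.Tendsto.mul_const (hπ z w) (.inr ENNReal.coe_ne_top)
    _ ≤ liminf (fun k : ℕ => (γ : ENNReal) ^ k * V z + (K / (1 - γ) : NNReal)) atTop :=
        liminf_le_liminf (.of_forall fun k => h.stepExp_le k z)
    _ = _ := hlim.liminf_eq

end IsLimitLaw

end Coupling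

/-! ### Exponential Lyapunov functions -/

section ExponentialDrift

variable {D η C θ w : ℝ}

theorem exists_expRate (hη : 0 < η) (hηD : η ≤ D) :
    ∃ θ : ℝ, 0 < θ ∧ θ * D ≤ 1 ∧ 4 * θ * D ^ 2 ≤ η := by
  have hD : 0 < D := hη.trans_le hηD
  refine ⟨η / (4 * D ^ 2), by positivity, ?_, le_of_eq (by field_simp)⟩
  rw [div_mul_eq_mul_div, div_le_one (by positivity)]
  nlinarith

theorem exp_mul_le_of_abs_sub_le {y : ℝ} (hθ : 0 ≤ θ) (hθD : θ * D ≤ 1) (hw : 0 < w)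
    (hy : |y - w| ≤ D) : Real.exp (θ * y) ≤
      Real.exp (θ * w) * (1 + θ / (2 * w) * (y ^ 2 - w ^ 2) + θ ^ 2 * D ^ 2) := by
  have habs : |θ * (y - w)| ≤ θ * D := by
    rw [abs_mul, abs_of_nonneg hθ]
    gcongr
  have hexp : Real.exp (θ * (y - w)) ≤ 1 + θ * (y - w) + (θ * (y - w)) ^ 2 := by
    linarith [(abs_le.1 (Real.abs_exp_sub_one_sub_id_le (habs.trans hθD))).2]
  have hsq : (θ * (y - w)) ^ 2 ≤ θ ^ 2 * D ^ 2 := by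
    rw [← mul_pow, ← sq_abs (θ * (y - w))]
    gcongr
  have hlin : θ * (y - w) ≤ θ / (2 * w) * (y ^ 2 - w ^ 2) := by
    rw [div_mul_eq_mul_div, le_div_iff₀ (by positivity)]
    nlinarith [mul_nonneg hθ (sq_nonneg (y - w))]
  calc Real.exp (θ * y) = Real.exp (θ * w) * Real.exp (θ * (y - w)) := by
        rw [← Real.exp_add]
        ring_nf
    _ ≤ _ := by
        gcongr
        linarith

variable {Ω : Type*} [MeasurableSpace Ω] {m : Measure Ω} {Y : Ω → ℝ}

theorem ae_exp_mul_le (hθ : 0 ≤ θ) (hYw : ∀ᵐ ω ∂m, |Y ω - w| ≤ D) :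
    ∀ᵐ ω ∂m, Real.exp (θ * Y ω) ≤ Real.exp (θ * (w + D)) := by
  filter_upwards [hYw] with ω hω
  gcongr
  linarith [(abs_le.1 hω).2]

theorem integrable_exp_mul_of_abs_sub_le [IsFiniteMeasure m] (hθ : 0 ≤ θ) (hY : AEMeasurable Y m)
    (hYw : ∀ᵐ ω ∂m, |Y ω - w| ≤ D) : Integrable (fun ω => Real.exp (θ * Y ω)) m := by
  refine Integrable.of_bound (hY.const_mul θ).exp.aestronglyMeasurable
    (Real.exp (θ * (w + D))) ?_
  simpa only [Real.norm_eq_abs, Real.abs_exp] using ae_exp_mul_le hθ hYw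

theorem integrable_sq_of_abs_sub_le [IsFiniteMeasure m] (hY : AEMeasurable Y m)
    (hYw : ∀ᵐ ω ∂m, |Y ω - w| ≤ D) : Integrable (fun ω => Y ω ^ 2) m := by
  refine Integrable.of_bound (hY.pow_const 2).aestronglyMeasurable ((|w| + D) ^ 2) ?_
  filter_upwards [hYw] with ω hω
  rw [norm_pow, Real.norm_eq_abs]
  gcongr
  linarith [abs_sub_abs_le_abs_sub (Y ω) w]

variable [IsProbabilityMeasure m]

theorem integral_exp_mul_le_of_sq_le (hθ : 0 ≤ θ) (hθD : θ * D ≤ 1) (hθη : 4 * θ * D ^ 2 ≤ η)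
    (hw : 0 < w) (hC : C ≤ η * w) (hY : AEMeasurable Y m) (hYw : ∀ᵐ ω ∂m, |Y ω - w| ≤ D)
    (hdrift : ∫ ω, Y ω ^ 2 ∂m ≤ w ^ 2 - 2 * η * w + C) :
    ∫ ω, Real.exp (θ * Y ω) ∂m ≤ (1 - θ * η / 4) * Real.exp (θ * w) := by
  have hY2 := integrable_sq_of_abs_sub_le hY hYw
  have hlin : θ / (2 * w) * (∫ ω, Y ω ^ 2 ∂m - w ^ 2) ≤ -(θ * η / 2) := by
    rw [div_mul_eq_mul_div, div_le_iff₀ (by positivity)]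
    nlinarith
  have hquad : θ ^ 2 * D ^ 2 ≤ θ * η / 4 := by nlinarith
  calc ∫ ω, Real.exp (θ * Y ω) ∂m
      ≤ ∫ ω, Real.exp (θ * w) * (1 + θ / (2 * w) * (Y ω ^ 2 - w ^ 2) + θ ^ 2 * D ^ 2) ∂m :=
        integral_mono_ae (integrable_exp_mul_of_abs_sub_le hθ hY hYw) (by fun_prop)
          (hYw.mono fun ω hω => exp_mul_le_of_abs_sub_le hθ hθD hw hω)
    _ = Real.exp (θ * w) * (1 + θ / (2 * w) * (∫ ω, Y ω ^ 2 ∂m - w ^ 2) + θ ^ 2 * D ^ 2) := by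
        rw [integral_const_mul, integral_add (by fun_prop) (by fun_prop),
          integral_add (by fun_prop) (by fun_prop), integral_const_mul,
          integral_sub hY2 (by fun_prop)]
        simp only [integral_const, probReal_univ, one_smul]
    _ ≤ (1 - θ * η / 4) * Real.exp (θ * w) := by
        rw [mul_comm]
        gcongr
        linarith

theorem integral_exp_mul_le (hθ : 0 ≤ θ) (hη : 0 < η) (hηD : η ≤ D) (hθD : θ * D ≤ 1)
    (hθη : 4 * θ * D ^ 2 ≤ η) (hC : 0 ≤ C) (hY : AEMeasurable Y m)
    (hYw : ∀ᵐ ω ∂m, |Y ω - w| ≤ D) (hdrift : ∫ ω, Y ω ^ 2 ∂m ≤ w ^ 2 - 2 * η * w + C) :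
    ∫ ω, Real.exp (θ * Y ω) ∂m ≤
      (1 - θ * η / 4) * Real.exp (θ * w) + Real.exp (θ * (C / η + D)) := by
  have hθη1 : θ * η ≤ 1 := (mul_le_mul_of_nonneg_left hηD hθ).trans hθD
  rcases le_or_gt w (C / η) with hnear | hfar
  · calc ∫ ω, Real.exp (θ * Y ω) ∂m ≤ ∫ _, Real.exp (θ * (C / η + D)) ∂m := by
          refine integral_mono_ae (integrable_exp_mul_of_abs_sub_le hθ hY hYw)
            (integrable_const _) ((ae_exp_mul_le hθ hYw).mono fun ω hω => hω.trans ?_)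
          exact Real.exp_le_exp.2 (by gcongr)
      _ = Real.exp (θ * (C / η + D)) := by
          simp only [integral_const, probReal_univ, one_smul]
      _ ≤ _ := le_add_of_nonneg_left (mul_nonneg (by linarith) (Real.exp_nonneg _))
  · have hw0 : 0 < w := (div_nonneg hC hη.le).trans_lt hfar
    have hCw : C ≤ η * w := by
      rw [div_lt_iff₀ hη] at hfar
      linarith
    exact (integral_exp_mul_le_of_sq_le hθ hθD hθη hw0 hCw hY hYw hdrift).trans
      (le_add_of_nonneg_right (Real.exp_nonneg _))

end ExponentialDrift

theorem pow_le_mul_exp {θ w : ℝ} (hθ : 0 < θ) (hw : 0 ≤ w) (r : ℕ) :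
    w ^ r ≤ r.factorial / θ ^ r * Real.exp (θ * w) := by
  have h := Real.pow_div_factorial_le_exp (θ * w) (by positivity) r
  rw [div_le_iff₀ (by positivity), mul_pow] at h
  rw [div_mul_eq_mul_div, le_div_iff₀ (by positivity)]
  linarith

section ExpLyapunov

variable {A : Type v}

/-- The exponential Lyapunov function `exp (θ f)`. -/
def expLyapunov (θ : ℝ) (f : A → ℝ) (x : A) : NNReal := (Real.exp (θ * f x)).toNNReal

theorem finite_expLyapunov_le {θ : ℝ} (hθ : 0 < θ) {f : A → ℝ}
    (hfin : ∀ c : ℝ, {x | f x ≤ c}.Finite) (R : NNReal) : {x | expLyapunov θ f x ≤ R}.Finite := by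
  refine (hfin (R / θ)).subset fun x hx => ?_
  have hexp : Real.exp (θ * f x) ≤ R := Real.toNNReal_le_iff_le_coe.1 hx
  change f x ≤ R / θ
  rw [le_div_iff₀ hθ]
  linarith [Real.add_one_le_exp (θ * f x)]

variable [Countable A] [MeasurableSpace A] [DiscreteMeasurableSpace A]

theorem lintegral_toMeasure (p : PMF A) (f : A → ENNReal) :
    ∫⁻ y, f y ∂p.toMeasure = ∑' y, p y * f y := by
  rw [lintegral_countable']
  refine tsum_congr fun y => ?_
  rw [PMF.toMeasure_apply_singleton _ _ MeasurableSet.of_discrete, mul_comm]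

variable {P : A → PMF A} {π : PMF A} {f : A → ℝ} {θ : ℝ} {γ K : NNReal}

theorem IsLimitLaw.lintegral_exp_le (hπ : IsLimitLaw P π)
    (h : GeometricDrift P (expLyapunov θ f) γ K) :
    ∫⁻ y, ENNReal.ofReal (Real.exp (θ * f y)) ∂π.toMeasure ≤ (K / (1 - γ) : NNReal) := by
  rw [lintegral_toMeasure]
  exact hπ.tsum_le_of_geometricDrift h

theorem IsLimitLaw.integrable_exp (hπ : IsLimitLaw P π)
    (h : GeometricDrift P (expLyapunov θ f) γ K) :
    Integrable (fun y => Real.exp (θ * f y)) π.toMeasure := by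
  refine ⟨(measurable_of_countable _).aestronglyMeasurable, ?_⟩
  rw [hasFiniteIntegral_iff_ofReal (.of_forall fun y => Real.exp_nonneg _)]
  exact (hπ.lintegral_exp_le h).trans_lt ENNReal.coe_lt_top

theorem IsLimitLaw.integral_exp_le (hπ : IsLimitLaw P π)
    (h : GeometricDrift P (expLyapunov θ f) γ K) :
    ∫ y, Real.exp (θ * f y) ∂π.toMeasure ≤ (K / (1 - γ) : NNReal) := by
  rw [integral_eq_lintegral_of_nonneg_ae (.of_forall fun y => Real.exp_nonneg _)
    (hπ.integrable_exp h).1]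
  exact ENNReal.toReal_le_of_le_ofReal (NNReal.coe_nonneg _)
    ((hπ.lintegral_exp_le h).trans_eq ENNReal.ofReal_coe_nnreal.symm)

theorem IsLimitLaw.integrable_pow (hπ : IsLimitLaw P π)
    (h : GeometricDrift P (expLyapunov θ f) γ K) (hθ : 0 < θ) (hf : ∀ y, 0 ≤ f y) (r : ℕ) :
    Integrable (fun y => f y ^ r) π.toMeasure := by
  refine ((hπ.integrable_exp h).const_mul (r.factorial / θ ^ r)).mono'
    (measurable_of_countable _).aestronglyMeasurable (.of_forall fun y => ?_)
  rw [Real.norm_of_nonneg (pow_nonneg (hf y) r)]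
  exact pow_le_mul_exp hθ (hf y) r

theorem IsLimitLaw.integral_pow_le (hπ : IsLimitLaw P π)
    (h : GeometricDrift P (expLyapunov θ f) γ K) (hθ : 0 < θ) (hf : ∀ y, 0 ≤ f y) (r : ℕ) :
    ∫ y, f y ^ r ∂π.toMeasure ≤ r.factorial / θ ^ r * (K / (1 - γ) : NNReal) :=
  calc ∫ y, f y ^ r ∂π.toMeasure
      ≤ ∫ y, r.factorial / θ ^ r * Real.exp (θ * f y) ∂π.toMeasure :=
        integral_mono (hπ.integrable_pow h hθ hf r) ((hπ.integrable_exp h).const_mul _)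
          fun y => pow_le_mul_exp hθ (hf y) r
    _ = r.factorial / θ ^ r * ∫ y, Real.exp (θ * f y) ∂π.toMeasure := integral_const_mul _ _
    _ ≤ _ := mul_le_mul_of_nonneg_left (hπ.integral_exp_le h) (by positivity)

end ExpLyapunov

section Invariant

variable {A : Type v} [Countable A] [MeasurableSpace A] [DiscreteMeasurableSpace A]
  {P : A → PMF A} {π : PMF A}

/-- The transition matrix `P` as a Markov kernel. -/
def transitionKernel (P : A → PMF A) : Kernel A A :=
  ⟨fun x => (P x).toMeasure, measurable_of_countable _⟩

theorem transitionKernel_comp_const (hπ : π.bind P = π) :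
    (transitionKernel P ∘ₖ Kernel.const Unit π.toMeasure) () = π.toMeasure := by
  refine Measure.ext_of_singleton fun y => ?_
  rw [Kernel.comp_apply' _ _ _ MeasurableSet.of_discrete, Kernel.const_apply,
    lintegral_toMeasure, PMF.toMeasure_apply_singleton _ _ MeasurableSet.of_discrete]
  conv_rhs => rw [← hπ, PMF.bind_apply]
  exact tsum_congr fun x => congrArg _ (PMF.toMeasure_apply_singleton _ _ MeasurableSet.of_discrete)

theorem integrable_integral_of_bind_eq (hπ : π.bind P = π) {f : A → ℝ}
    (hf : Integrable f π.toMeasure) :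
    Integrable (fun x => ∫ y, f y ∂(P x).toMeasure) π.toMeasure := by
  rw [← transitionKernel_comp_const hπ] at hf
  exact hf.integral_comp

theorem integral_integral_of_bind_eq (hπ : π.bind P = π) {f : A → ℝ}
    (hf : Integrable f π.toMeasure) :
    ∫ x, ∫ y, f y ∂(P x).toMeasure ∂π.toMeasure = ∫ x, f x ∂π.toMeasure := by
  rw [← transitionKernel_comp_const hπ] at hf
  have hcomp := Kernel.integral_comp hf
  rw [transitionKernel_comp_const hπ] at hcomp
  exact hcomp.symm

theorem integrable_drift_of_bind_eq (hπ : π.bind P = π) {f : A → ℝ}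
    (hf : Integrable f π.toMeasure) :
    Integrable (fun x => ∫ y, f y ∂(P x).toMeasure - f x) π.toMeasure :=
  (integrable_integral_of_bind_eq hπ hf).sub hf

theorem integral_drift_of_bind_eq (hπ : π.bind P = π) {f : A → ℝ}
    (hf : Integrable f π.toMeasure) :
    ∫ x, (∫ y, f y ∂(P x).toMeasure - f x) ∂π.toMeasure = 0 := by
  rw [integral_sub (integrable_integral_of_bind_eq hπ hf) hf, integral_integral_of_bind_eq hπ hf,
    sub_self]

theorem abs_const_mul_integral_sub_le_of_abs_drift_le (hπ : π.bind P = π) {f h k : A → ℝ}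
    (hf : Integrable f π.toMeasure) (hh : Integrable h π.toMeasure)
    (hk : Integrable k π.toMeasure) {α β b δ e : ℝ}
    (hdrift : ∀ x, |∫ y, f y ∂(P x).toMeasure - f x + α * h x - b| ≤
      δ * ∫ y, k y ∂(P x).toMeasure + β * (∫ y, h y ∂(P x).toMeasure - h x + e)) :
    |α * ∫ x, h x ∂π.toMeasure - b| ≤ δ * ∫ x, k x ∂π.toMeasure + β * e := by
  have hkP := integrable_integral_of_bind_eq hπ hk
  have hfDrift := integrable_drift_of_bind_eq hπ hf
  have hhDrift := integrable_drift_of_bind_eq hπ hh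
  have hsum := hfDrift.fun_add (hh.const_mul α)
  have hgrowth := hhDrift.fun_add (integrable_const e)
  calc |α * ∫ x, h x ∂π.toMeasure - b|
      = |∫ x, (∫ y, f y ∂(P x).toMeasure - f x + α * h x - b) ∂π.toMeasure| := by
        rw [integral_sub hsum (integrable_const _), integral_add hfDrift (hh.const_mul _),
          integral_drift_of_bind_eq hπ hf, integral_const_mul]
        simp only [zero_add, integral_const, probReal_univ, one_smul]
    _ ≤ ∫ x, |∫ y, f y ∂(P x).toMeasure - f x + α * h x - b| ∂π.toMeasure :=
        abs_integral_le_integral_abs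
    _ ≤ ∫ x, (δ * ∫ y, k y ∂(P x).toMeasure + β * (∫ y, h y ∂(P x).toMeasure - h x + e))
          ∂π.toMeasure :=
        integral_mono (hsum.sub (integrable_const _)).abs
          ((hkP.const_mul _).add (hgrowth.const_mul _)) hdrift
    _ = δ * ∫ x, k x ∂π.toMeasure + β * e := by
        rw [integral_add (hkP.const_mul _) (hgrowth.const_mul _), integral_const_mul,
          integral_const_mul, integral_add hhDrift (integrable_const _),
          integral_drift_of_bind_eq hπ hh, integral_integral_of_bind_eq hπ hk]
        simp only [zero_add, integral_const, probReal_univ, one_smul]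

end Invariant

/-! ### Geometry of the cone and of its span -/

section Geometry

variable {n : ℕ}

theorem projK_mem (x : Vec n) : projK x ∈ coneK n := (exists_projK x).choose_spec.1

theorem zero_mem_coneK : (0 : Vec n) ∈ coneK n := ⟨(spaceS n).zero_mem, fun _ => le_rfl⟩

theorem norm_perpK_le {x z : Vec n} (hz : z ∈ coneK n) : ‖perpK x‖ ≤ ‖x - z‖ :=
  (exists_projK x).choose_spec.2 z hz

theorem norm_perpK_le_norm (x : Vec n) : ‖perpK x‖ ≤ ‖x‖ := by
  simpa only [sub_zero] using norm_perpK_le (x := x) zero_mem_coneK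

theorem norm_perpK_le_add (x y : Vec n) : ‖perpK x‖ ≤ ‖perpK y‖ + ‖x - y‖ :=
  calc ‖perpK x‖ ≤ ‖x - projK y‖ := norm_perpK_le (projK_mem y)
    _ = ‖perpK y + (x - y)‖ := by rw [perpK, add_comm, sub_add_sub_cancel]
    _ ≤ ‖perpK y‖ + ‖x - y‖ := norm_add_le _ _

theorem abs_norm_perpK_sub_le (x y : Vec n) : |‖perpK x‖ - ‖perpK y‖| ≤ ‖x - y‖ := by
  have hyx := norm_perpK_le_add y x
  rw [norm_sub_rev] at hyx
  exact abs_sub_le_iff.2 ⟨by linarith [norm_perpK_le_add x y], by linarith⟩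

theorem norm_sub_starProjection_le_norm_perpK (x : Vec n) :
    ‖x - (spaceS n).starProjection x‖ ≤ ‖perpK x‖ := by
  rw [Submodule.starProjection_minimal]
  exact ciInf_le ⟨0, Set.forall_mem_range.2 fun _ => norm_nonneg _⟩
    (⟨projK x, (projK_mem x).1⟩ : spaceS n)

@[simp]
theorem vec_apply (M : Fin n → Fin n → ℝ) (i j : Fin n) : vec M (i, j) = M i j := rfl

@[simp]
theorem natVec_apply (M : NMat n) (i j : Fin n) : natVec M (i, j) = M i j := rfl

theorem natVec_nonneg (M : NMat n) (p : Fin n × Fin n) : 0 ≤ natVec M p := Nat.cast_nonneg _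

theorem inner_eq_sum (x y : Vec n) : inner ℝ x y = ∑ i, ∑ j, x (i, j) * y (i, j) := by
  simp only [PiLp.inner_apply, Fintype.sum_prod_type, RCLike.inner_apply, conj_trivial, mul_comm]

theorem norm_sq_eq_sum (x : Vec n) : ‖x‖ ^ 2 = ∑ i, ∑ j, x (i, j) ^ 2 := by
  simp only [← real_inner_self_eq_norm_sq, inner_eq_sum, ← sq]

/-- The sum of all entries of a matrix. -/
def total (x : Vec n) : ℝ := ∑ i, ∑ j, x (i, j)

/-- The matrices with all row sums and all column sums equal to `1`; entries may be negative. -/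
def UnitSums (x : Vec n) : Prop := (∀ i, ∑ j, x (i, j) = 1) ∧ ∀ j, ∑ i, x (i, j) = 1

theorem entry_le_norm (x : Vec n) (p : Fin n × Fin n) : x p ≤ ‖x‖ :=
  (le_abs_self _).trans (PiLp.norm_apply_le x p)

theorem total_le_norm (x : Vec n) : total x ≤ n ^ 2 * ‖x‖ :=
  calc total x ≤ ∑ _i : Fin n, ∑ _j : Fin n, ‖x‖ :=
        Finset.sum_le_sum fun i _ => Finset.sum_le_sum fun j _ => entry_le_norm x (i, j)
    _ = n ^ 2 * ‖x‖ := by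
        simp only [Finset.sum_const, Finset.card_univ, Fintype.card_fin, nsmul_eq_mul]
        ring

theorem norm_le_total {x : Vec n} (hx : ∀ p, 0 ≤ x p) : ‖x‖ ≤ total x := by
  have htotal : total x = ∑ p, x p := (Fintype.sum_prod_type _).symm
  have hnonneg : 0 ≤ ∑ p, x p := Finset.sum_nonneg fun p _ => hx p
  refine le_of_sq_le_sq ?_ (htotal ▸ hnonneg)
  rw [norm_sq_eq_sum, ← Fintype.sum_prod_type (fun p : Fin n × Fin n => x p ^ 2), htotal,
    sq (∑ p, x p), Finset.sum_mul]
  refine Finset.sum_le_sum fun p hp => ?_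
  rw [sq]
  exact mul_le_mul_of_nonneg_left (Finset.single_le_sum (fun p _ => hx p) hp) (hx p)

theorem finite_natVec_norm_le (R : ℝ) : {M : NMat n | ‖natVec M‖ ≤ R}.Finite := by
  refine (Set.finite_Icc (0 : NMat n) fun _ _ => ⌈R⌉₊).subset fun M hM => ?_
  refine ⟨fun i j => Nat.zero_le _, fun i j => ?_⟩
  have hle : (M i j : ℝ) ≤ ⌈R⌉₊ :=
    (entry_le_norm (natVec M) (i, j)).trans (hM.trans (Nat.le_ceil R))
  exact_mod_cast hle

theorem inner_eq_of_eq_add {p : Vec n} {w w' : Fin n → ℝ} (hp : ∀ i j, p (i, j) = w i + w' j)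
    (x : Vec n) :
    inner ℝ p x = ∑ i, w i * ∑ j, x (i, j) + ∑ j, w' j * ∑ i, x (i, j) := by
  simp only [inner_eq_sum, hp, add_mul, Finset.sum_add_distrib, Finset.mul_sum]
  rw [Finset.sum_comm (f := fun i j => w' j * x (i, j))]

theorem mem_orthogonal_spaceS {x : Vec n} (hrow : ∀ i, ∑ j, x (i, j) = 0)
    (hcol : ∀ j, ∑ i, x (i, j) = 0) : x ∈ (spaceS n)ᗮ := by
  rintro p ⟨w, w', hp⟩
  simp only [inner_eq_of_eq_add hp, hrow, hcol, mul_zero, Finset.sum_const_zero, add_zero]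

theorem starProjection_spaceS_apply (x : Vec n) (i j : Fin n) :
    (spaceS n).starProjection x (i, j) =
      ((∑ l, x (i, l)) / n - total x / n ^ 2) + (∑ k, x (k, j)) / n := by
  have hn : (n : ℝ) ≠ 0 := Nat.cast_ne_zero.2 i.pos.ne'
  let y : Vec n := vec fun i j =>
    ((∑ l, x (i, l)) / n - total x / n ^ 2) + (∑ k, x (k, j)) / n
  have hy : y ∈ spaceS n :=
    ⟨fun i => (∑ l, x (i, l)) / n - total x / n ^ 2, fun j => (∑ k, x (k, j)) / n,
      fun _ _ => rfl⟩
  have hcols : ∑ j, ∑ k, x (k, j) = total x := Finset.sum_comm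
  have hrows : ∑ i, ∑ l, x (i, l) = total x := rfl
  have hperp : x - y ∈ (spaceS n)ᗮ := by
    refine mem_orthogonal_spaceS (fun i => ?_) fun j => ?_ <;>
    · simp only [y, PiLp.sub_apply, vec_apply, Finset.sum_sub_distrib, Finset.sum_add_distrib,
        Finset.sum_const, Finset.card_univ, Fintype.card_fin, nsmul_eq_mul, ← Finset.sum_div,
        hcols, hrows]
      field_simp
      ring
  rw [Submodule.eq_starProjection_of_mem_orthogonal hy hperp]
  rfl

theorem norm_starProjection_spaceS_sq (x : Vec n) : ‖(spaceS n).starProjection x‖ ^ 2 =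
    (∑ i, (∑ l, x (i, l)) ^ 2) / n + (∑ j, (∑ k, x (k, j)) ^ 2) / n - total x ^ 2 / n ^ 2 := by
  have hinner : inner ℝ ((spaceS n).starProjection x) x = ‖(spaceS n).starProjection x‖ ^ 2 :=
    (spaceS n).re_inner_starProjection_eq_normSq x
  rw [← hinner, inner_eq_of_eq_add (starProjection_spaceS_apply x)]
  simp only [sub_mul, Finset.sum_sub_distrib, div_mul_eq_mul_div, ← Finset.sum_div, ← sq,
    ← Finset.mul_sum]
  rw [show ∑ i, ∑ j, x (i, j) = total x from rfl]
  ring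

namespace UnitSums

variable {x y : Vec n}

theorem total_eq (hx : UnitSums x) : total x = n := by
  simp only [total, hx.1, Finset.sum_const, Finset.card_univ, Fintype.card_fin, nsmul_eq_mul,
    mul_one]

theorem sub_mem_orthogonal (hx : UnitSums x) (hy : UnitSums y) : x - y ∈ (spaceS n)ᗮ :=
  mem_orthogonal_spaceS
    (fun i => by simp only [PiLp.sub_apply, Finset.sum_sub_distrib, hx.1, hy.1, sub_self])
    fun j => by simp only [PiLp.sub_apply, Finset.sum_sub_distrib, hx.2, hy.2, sub_self]

theorem starProjection_eq (hx : UnitSums x) (hy : UnitSums y) :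
    (spaceS n).starProjection x = (spaceS n).starProjection y := by
  rw [← sub_eq_zero, ← map_sub]
  exact ((spaceS n).starProjection_apply_eq_zero_iff).2 (hx.sub_mem_orthogonal hy)

theorem inner_eq (hx : UnitSums x) (hy : UnitSums y) {p : Vec n} (hp : p ∈ spaceS n) :
    inner ℝ p x = inner ℝ p y := by
  rw [← sub_eq_zero, ← inner_sub_right]
  exact hx.sub_mem_orthogonal hy p hp

theorem inner_starProjection (hx : UnitSums x) (y : Vec n) :
    inner ℝ ((spaceS n).starProjection y) x = total y / n := by
  rw [inner_eq_of_eq_add (starProjection_spaceS_apply y)]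
  simp only [hx.1, hx.2, mul_one, Finset.sum_sub_distrib, ← Finset.sum_div, Finset.sum_const,
    Finset.card_univ, Fintype.card_fin, nsmul_eq_mul]
  rw [Finset.sum_comm (f := fun j k => y (k, j)), ← total]
  rcases eq_or_ne (n : ℝ) 0 with hn | hn
  · simp [hn]
  · field_simp
    ring

end UnitSums

theorem IsSchedule.unitSums {s : NMat n} (hs : IsSchedule s) : UnitSums (natVec s) := by
  obtain ⟨τ, hτ⟩ := hs
  refine ⟨fun i => ?_, fun j => ?_⟩
  · simp [hτ]
  · simp [hτ, ← Equiv.eq_symm_apply]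

theorem IsSchedule.le_one {s : NMat n} (hs : IsSchedule s) (i j : Fin n) : s i j ≤ 1 := by
  obtain ⟨τ, hτ⟩ := hs
  rw [hτ]
  split_ifs <;> simp

theorem unitSums_of_mem_doublyStochastic {ν : Matrix (Fin n) (Fin n) ℝ}
    (hν : ν ∈ doublyStochastic ℝ (Fin n)) : UnitSums (vec ν) :=
  (mem_doublyStochastic_iff_sum.1 hν).2

end Geometry

/-! ### One time slot -/

/-- One slot of the queue dynamics: `q' = [q + a - s]⁺` for a schedule `s`, where `q` is the old
and `q'` the new matrix of queue lengths, and `a` are the arrivals. -/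
structure QueueStep {n : ℕ} (q a s q' : NMat n) : Prop where
  isSchedule : IsSchedule s
  queue_eq : ∀ i j, q' i j = q i j + a i j - s i j

/-- The unused service `u`, defined by `q' = q + a - s + u`. -/
def unusedService {n : ℕ} (q a s q' : NMat n) : Vec n := natVec q' - natVec q - natVec a + natVec s

/-- The part of the change of `‖Pq‖²`, with `P` the projection onto `𝒮`, that the arrivals and the
old queue lengths do not account for. -/
def projectionResidual {n : ℕ} (ν : Matrix (Fin n) (Fin n) ℝ)
    (q a q' : NMat n) : ℝ :=
  ‖(spaceS n).starProjection (natVec q')‖ ^ 2 - ‖(spaceS n).starProjection (natVec q)‖ ^ 2 -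
    2 * (inner ℝ ((spaceS n).starProjection (natVec q)) (natVec a) - total (natVec q) / n) -
    ‖(spaceS n).starProjection (natVec a - vec ν)‖ ^ 2

namespace QueueStep

variable {n : ℕ} {q a s q' : NMat n} {ν : Matrix (Fin n) (Fin n) ℝ} {aMax : ℕ}

theorem unusedService_apply_cases (h : QueueStep q a s q') (i j : Fin n) :
    unusedService q a s q' (i, j) = 0 ∨
      unusedService q a s q' (i, j) = 1 ∧ q i j = 0 ∧ q' i j = 0 := by
  have hs := h.isSchedule.le_one i j
  have hq := h.queue_eq i j
  simp only [unusedService, PiLp.add_apply, PiLp.sub_apply, natVec_apply]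
  rcases le_or_gt (s i j) (q i j + a i j) with hle | hlt
  · have hsum : (q' i j : ℝ) + s i j = q i j + a i j := by
      exact_mod_cast (by lia : q' i j + s i j = q i j + a i j)
    exact .inl (by linarith)
  · obtain ⟨hq0, ha0, hs1, hq'0⟩ : q i j = 0 ∧ a i j = 0 ∧ s i j = 1 ∧ q' i j = 0 := by lia
    exact .inr ⟨by simp [hq0, ha0, hs1, hq'0], hq0, hq'0⟩

theorem unusedService_nonneg (h : QueueStep q a s q') (p : Fin n × Fin n) :
    0 ≤ unusedService q a s q' p := by
  rcases h.unusedService_apply_cases p.1 p.2 with hu | ⟨hu, -⟩ <;> simp [hu]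

theorem inner_queue_unusedService (h : QueueStep q a s q') :
    inner ℝ (natVec q) (unusedService q a s q') = 0 := by
  rw [inner_eq_sum]
  refine Finset.sum_eq_zero fun i _ => Finset.sum_eq_zero fun j _ => ?_
  rcases h.unusedService_apply_cases i j with hu | ⟨-, hq, -⟩ <;> simp [*]

theorem inner_nextQueue_unusedService (h : QueueStep q a s q') :
    inner ℝ (natVec q') (unusedService q a s q') = 0 := by
  rw [inner_eq_sum]
  refine Finset.sum_eq_zero fun i _ => Finset.sum_eq_zero fun j _ => ?_
  rcases h.unusedService_apply_cases i j with hu | ⟨-, -, hq'⟩ <;> simp [*]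

theorem inner_unusedService_nonneg (h : QueueStep q a s q') {p : Vec n} (hp : p ∈ coneK n) :
    0 ≤ inner ℝ p (unusedService q a s q') := by
  rw [inner_eq_sum]
  exact Finset.sum_nonneg fun i _ => Finset.sum_nonneg fun j _ =>
    mul_nonneg (hp.2 _) (h.unusedService_nonneg _)

theorem norm_unusedService_sq (h : QueueStep q a s q') :
    ‖unusedService q a s q'‖ ^ 2 = total (unusedService q a s q') := by
  rw [norm_sq_eq_sum, total]
  refine Finset.sum_congr rfl fun i _ => Finset.sum_congr rfl fun j _ => ?_
  rcases h.unusedService_apply_cases i j with hu | ⟨hu, -⟩ <;> simp [hu]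

theorem total_unusedService (h : QueueStep q a s q') :
    total (unusedService q a s q') =
      total (natVec q') - total (natVec q) - total (natVec a) + n := by
  rw [← h.isSchedule.unitSums.total_eq]
  simp only [total, unusedService, PiLp.add_apply, PiLp.sub_apply, Finset.sum_add_distrib,
    Finset.sum_sub_distrib]

theorem abs_nextQueue_sub_queue_le (h : QueueStep q a s q') (ha : ∀ i j, a i j ≤ aMax)
    (i j : Fin n) : |(q' i j : ℝ) - q i j| ≤ aMax + 1 := by
  have hs := h.isSchedule.le_one i j
  have hq := h.queue_eq i j
  have haij := ha i j
  have hup : (q' i j : ℝ) ≤ q i j + aMax := by exact_mod_cast (by lia : q' i j ≤ q i j + aMax)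
  have hdown : (q i j : ℝ) ≤ q' i j + 1 := by exact_mod_cast (by lia : q i j ≤ q' i j + 1)
  have : (0 : ℝ) ≤ aMax := Nat.cast_nonneg _
  exact abs_le.2 ⟨by linarith, by linarith⟩

theorem norm_nextQueue_sub_queue_le (h : QueueStep q a s q') (ha : ∀ i j, a i j ≤ aMax) :
    ‖natVec q' - natVec q‖ ≤ n * (aMax + 1) := by
  refine le_of_sq_le_sq ?_ (by positivity)
  rw [norm_sq_eq_sum]
  calc ∑ i, ∑ j, (natVec q' - natVec q) (i, j) ^ 2
      ≤ ∑ _i : Fin n, ∑ _j : Fin n, ((aMax : ℝ) + 1) ^ 2 :=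
        Finset.sum_le_sum fun i _ => Finset.sum_le_sum fun j _ =>
          sq_le_sq.2 ((h.abs_nextQueue_sub_queue_le ha i j).trans (le_abs_self _))
    _ = (n * (aMax + 1)) ^ 2 := by
        simp only [Finset.sum_const, Finset.card_univ, Fintype.card_fin, nsmul_eq_mul]
        ring

theorem inner_sub_nextQueue_sub_queue_le (h : QueueStep q a s q') (hν : UnitSums (vec ν))
    {p : Vec n} (hp : p ∈ coneK n) :
    inner ℝ (natVec q - p) (natVec q' - natVec q) ≤
      inner ℝ (natVec q - p) (natVec a) - inner ℝ (natVec q) (natVec s) + inner ℝ p (vec ν) := by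
  have hstep : natVec q' - natVec q = natVec a - natVec s + unusedService q a s q' := by
    rw [unusedService]
    abel
  rw [hstep, inner_add_right, inner_sub_right, inner_sub_left _ _ (natVec s),
    inner_sub_left _ _ (unusedService q a s q'), h.inner_queue_unusedService,
    h.isSchedule.unitSums.inner_eq hν hp.1]
  linarith [h.inner_unusedService_nonneg hp]

theorem norm_nextQueue_sub_sq_le (h : QueueStep q a s q') (ha : ∀ i j, a i j ≤ aMax)
    (hν : UnitSums (vec ν)) {p : Vec n} (hp : p ∈ coneK n) :
    ‖natVec q' - p‖ ^ 2 ≤ ‖natVec q - p‖ ^ 2 +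
      2 * (inner ℝ (natVec q - p) (natVec a) - inner ℝ (natVec q) (natVec s) +
        inner ℝ p (vec ν)) + (n * (aMax + 1)) ^ 2 := by
  have hsq : ‖natVec q' - natVec q‖ ^ 2 ≤ (n * (aMax + 1)) ^ 2 :=
    pow_le_pow_left₀ (norm_nonneg _) (h.norm_nextQueue_sub_queue_le ha) 2
  rw [show natVec q' - p = (natVec q - p) + (natVec q' - natVec q) by abel, norm_add_sq_real]
  linarith [h.inner_sub_nextQueue_sub_queue_le hν hp]

theorem projectionResidual_eq (h : QueueStep q a s q') (hν : UnitSums (vec ν)) :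
    projectionResidual ν q a q' =
      2 * inner ℝ ((spaceS n).starProjection (natVec q')) (unusedService q a s q') -
        ‖(spaceS n).starProjection (unusedService q a s q')‖ ^ 2 := by
  set P := (spaceS n).starProjection
  set u := unusedService q a s q' with hu
  have hinner : ∀ x y : Vec n, inner ℝ (P x) (P y) = inner ℝ (P x) y := fun x y => by
    rw [← (spaceS n).inner_starProjection_left_eq_right,
      (spaceS n).starProjection_eq_self_iff.2 ((spaceS n).starProjection_apply_mem x)]
  have hstep : P (natVec q') - P u = P (natVec q) + P (natVec a - vec ν) := by
    rw [map_sub, ← h.isSchedule.unitSums.starProjection_eq hν, hu, unusedService]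
    simp only [map_add, map_sub]
    abel
  have hcross : inner ℝ (P (natVec q)) (P (natVec a - vec ν)) =
      inner ℝ (P (natVec q)) (natVec a) - total (natVec q) / n := by
    rw [hinner, inner_sub_right, hν.inner_starProjection]
  have hnorm := congrArg (fun v => ‖v‖ ^ 2) hstep
  simp only [norm_sub_sq_real, norm_add_sq_real, hcross, hinner] at hnorm
  rw [projectionResidual]
  linarith

/-- Since `u ⊥ q'`, only the part of `q'` orthogonal to `𝒮` contributes. -/
theorem abs_inner_starProjection_unusedService_le (h : QueueStep q a s q') :
    |inner ℝ ((spaceS n).starProjection (natVec q')) (unusedService q a s q')| ≤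
      ‖perpK (natVec q')‖ * ‖unusedService q a s q'‖ := by
  have hinner : inner ℝ ((spaceS n).starProjection (natVec q')) (unusedService q a s q') =
      -inner ℝ (natVec q' - (spaceS n).starProjection (natVec q')) (unusedService q a s q') := by
    rw [inner_sub_left, h.inner_nextQueue_unusedService]
    ring
  rw [hinner, abs_neg]
  exact (abs_real_inner_le_norm _ _).trans
    (mul_le_mul_of_nonneg_right (norm_sub_starProjection_le_norm_perpK _) (norm_nonneg _))

theorem abs_projectionResidual_le (h : QueueStep q a s q') (hν : UnitSums (vec ν)) {δ : ℝ}
    (hδ : 0 < δ) :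
    |projectionResidual ν q a q'| ≤ δ * ‖perpK (natVec q')‖ ^ 2 +
      (1 / δ + 1) * (total (natVec q') - total (natVec q) - total (natVec a) + n) := by
  rw [h.projectionResidual_eq hν, ← h.total_unusedService, ← h.norm_unusedService_sq]
  set u := unusedService q a s q'
  have hcross := h.abs_inner_starProjection_unusedService_le
  have hproj : ‖(spaceS n).starProjection u‖ ^ 2 ≤ ‖u‖ ^ 2 :=
    pow_le_pow_left₀ (norm_nonneg _) ((spaceS n).norm_starProjection_apply_le u) 2
  have hamgm : 2 * (‖perpK (natVec q')‖ * ‖u‖) ≤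
      δ * ‖perpK (natVec q')‖ ^ 2 + 1 / δ * ‖u‖ ^ 2 := by
    have hsq : 0 ≤ (δ * ‖perpK (natVec q')‖ - ‖u‖) ^ 2 / δ := by positivity
    have hexpand : (δ * ‖perpK (natVec q')‖ - ‖u‖) ^ 2 / δ =
        δ * ‖perpK (natVec q')‖ ^ 2 - 2 * (‖perpK (natVec q')‖ * ‖u‖) + 1 / δ * ‖u‖ ^ 2 := by
      field_simp
      ring
    linarith
  have hnonneg := sq_nonneg ‖(spaceS n).starProjection u‖
  rw [abs_le] at hcross ⊢
  constructor <;> linarith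

end QueueStep

/-! ### The chain of a switch -/

theorem measure_eq_tsum_inter_preimage {Ω B : Type*} [MeasurableSpace Ω] (μ : Measure Ω)
    [Countable B] [MeasurableSpace B] [MeasurableSingletonClass B] {Y : Ω → B} (hY : Measurable Y)
    {E : Set Ω} (hE : MeasurableSet E) : μ E = ∑' b, μ (Y ⁻¹' {b} ∩ E) := by
  have hfiber : ∀ b, MeasurableSet (Y ⁻¹' {b}) := fun b => hY (measurableSet_singleton b)
  have hcover : E = ⋃ b, Y ⁻¹' {b} ∩ E := by
    rw [← Set.iUnion_inter, ← Set.preimage_iUnion, Set.iUnion_of_singleton, Set.preimage_univ,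
      Set.univ_inter]
  refine (congrArg μ hcover).trans
    (measure_iUnion (fun b c hbc => ?_) fun b => (hfiber b).inter hE)
  exact ((Set.disjoint_singleton.2 hbc).preimage Y).mono Set.inter_subset_left
    Set.inter_subset_left

namespace SwitchSystem

section Chain

variable {n : ℕ} (S : SwitchSystem.{u, v} n)

instance instMeasurableSpaceState : MeasurableSpace S.A := ⊤

instance instDiscreteMeasurableSpaceState : DiscreteMeasurableSpace S.A := ⟨fun _ => trivial⟩

theorem measurable_X (t : ℕ) : Measurable (S.X t) := measurable_to_countable' (S.measurableSet_X t)

theorem measure_path_inter_X (t : ℕ) (p : Fin (t + 1) → S.A) (y : S.A) :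
    S.μ ((fun ω (k : Fin (t + 1)) => S.X k ω) ⁻¹' {p} ∩ {ω | S.X (t + 1) ω = y}) =
      S.μ ((fun ω (k : Fin (t + 1)) => S.X k ω) ⁻¹' {p}) * S.P (p (Fin.last t)) y := by
  let path : ℕ → S.A := fun k => if h : k < t + 1 then p ⟨k, h⟩ else y
  have hpath : ∀ k (h : k < t + 1), path k = p ⟨k, h⟩ := fun k h => dif_pos h
  have hlast : path t = p (Fin.last t) := hpath t t.lt_succ_self
  have hnext : path (t + 1) = y := dif_neg (lt_irrefl _)
  have hpast : (fun ω (k : Fin (t + 1)) => S.X k ω) ⁻¹' {p} =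
      {ω | ∀ k ≤ t, S.X k ω = path k} := by
    ext ω
    simp only [Set.mem_preimage, Set.mem_singleton_iff, funext_iff, Fin.forall_iff,
      Nat.lt_succ_iff, Set.mem_ofPred_eq]
    exact forall₂_congr fun k hk => by rw [hpath k (Nat.lt_succ_iff.2 hk)]
  have hfuture : {ω | ∀ k ≤ t, S.X k ω = path k} ∩ {ω | S.X (t + 1) ω = y} =
      {ω | ∀ k ≤ t + 1, S.X k ω = path k} := by
    ext ω
    simp only [Set.mem_inter_iff, Set.mem_ofPred_eq, Nat.le_succ_iff, or_imp, forall_and,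
      forall_eq, hnext]
  rw [hpast, hfuture, S.markov, hlast, hnext]

theorem measure_X_inter_X_succ (t : ℕ) (x y : S.A) :
    S.μ ({ω | S.X t ω = x} ∩ {ω | S.X (t + 1) ω = y}) = S.μ {ω | S.X t ω = x} * S.P x y := by
  have hpath : Measurable fun ω (k : Fin (t + 1)) => S.X k ω :=
    measurable_pi_lambda _ fun k => S.measurable_X k
  rw [measure_eq_tsum_inter_preimage S.μ hpath
      ((S.measurableSet_X t x).inter (S.measurableSet_X (t + 1) y)),
    measure_eq_tsum_inter_preimage S.μ hpath (S.measurableSet_X t x), ← ENNReal.tsum_mul_right]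
  refine tsum_congr fun p => ?_
  rw [← Set.inter_assoc]
  by_cases hp : p (Fin.last t) = x
  · have hsub : (fun ω (k : Fin (t + 1)) => S.X k ω) ⁻¹' {p} ⊆ {ω | S.X t ω = x} :=
      fun ω hω => (congrFun hω (Fin.last t)).trans hp
    rw [Set.inter_eq_left.2 hsub, measure_path_inter_X, hp]
  · have hempty : (fun ω (k : Fin (t + 1)) => S.X k ω) ⁻¹' {p} ∩ {ω | S.X t ω = x} = ∅ :=
      Set.eq_empty_of_forall_notMem fun ω hω => hp ((congrFun hω.1 (Fin.last t)).symm.trans hω.2)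
    rw [hempty, Set.empty_inter, measure_empty, zero_mul]

/-- The initial distribution of the chain. -/
def initDist : PMF S.A :=
  ⟨fun x => S.μ {ω | S.X 0 ω = x}, by
    have hsum := measure_eq_tsum_inter_preimage S.μ (S.measurable_X 0) MeasurableSet.univ
    simp only [measure_univ, Set.inter_univ] at hsum
    rw [hsum]
    exact ENNReal.summable.hasSum⟩

theorem measure_X (t : ℕ) (y : S.A) :
    S.μ {ω | S.X t ω = y} = S.initDist.bind (stepDist S.P t) y := by
  induction t generalizing y with
  | zero => exact congrArg (· y) S.initDist.bind_pure.symm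
  | succ t ih =>
    have hstep : S.initDist.bind (stepDist S.P (t + 1)) =
        (S.initDist.bind (stepDist S.P t)).bind S.P := by
      simp only [PMF.bind_bind, ← stepDist_succ']
    rw [measure_eq_tsum_inter_preimage S.μ (S.measurable_X t) (S.measurableSet_X (t + 1) y),
      hstep, PMF.bind_apply]
    exact tsum_congr fun x => (S.measure_X_inter_X_succ t x y).trans (by rw [ih])

theorem map_X (t : ℕ) : S.μ.map (S.X t) = (S.initDist.bind (stepDist S.P t)).toMeasure := by
  refine Measure.ext_of_singleton fun y => ?_
  rw [Measure.map_apply (S.measurable_X t) MeasurableSet.of_discrete,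
    PMF.toMeasure_apply_singleton _ _ MeasurableSet.of_discrete, ← measure_X]
  rfl

theorem exists_measure_X_ne_zero (hirr : Irreducible S.P) (y : S.A) :
    ∃ t, S.μ {ω | S.X t ω = y} ≠ 0 := by
  obtain ⟨x, hx⟩ := S.initDist.support_nonempty
  obtain ⟨k, hk⟩ := hirr x y
  refine ⟨k, ?_⟩
  rw [measure_X, PMF.bind_apply]
  exact fun h => mul_ne_zero ((PMF.mem_support_iff _ _).1 hx) hk (ENNReal.tsum_eq_zero.1 h x)

/-- The conditional law given `X(t) = x`. -/
abbrev condX (t : ℕ) (x : S.A) : Measure S.Ω := ProbabilityTheory.cond S.μ {ω | S.X t ω = x}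

variable {S} {t : ℕ} {x : S.A}

theorem ae_q_condX (hA : S.CondA2) : ∀ᵐ ω ∂S.condX t x, S.q t ω = S.g x := by
  filter_upwards [ae_cond_mem (S.measurableSet_X t x)] with ω hω
  rw [hA.1, hω]

theorem map_X_condX (hx : S.μ {ω | S.X t ω = x} ≠ 0) :
    (S.condX t x).map (S.X (t + 1)) = (S.P x).toMeasure := by
  refine Measure.ext_of_singleton fun y => ?_
  rw [Measure.map_apply (S.measurable_X _) MeasurableSet.of_discrete,
    PMF.toMeasure_apply_singleton _ _ MeasurableSet.of_discrete,
    cond_apply (S.measurableSet_X t x)]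
  change _ * S.μ (_ ∩ {ω | S.X (t + 1) ω = y}) = _
  rw [measure_X_inter_X_succ, ← mul_assoc, ENNReal.inv_mul_cancel hx (by finiteness), one_mul]

theorem map_a_condX (hA : S.CondA1) (hx : S.μ {ω | S.X t ω = x} ≠ 0) :
    (S.condX t x).map (S.a t) = S.μ.map (S.a t) := by
  ext B hB
  rw [Measure.map_apply (S.measurable_a t) hB, Measure.map_apply (S.measurable_a t) hB,
    cond_apply (S.measurableSet_X t x), Set.inter_comm,
    (Indep_iff _ _ _).1 (S.nonanticipating t) _ _ ⟨B, hB, rfl⟩ (hA.1 t x), mul_comm (S.μ _),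
    ← mul_assoc, ENNReal.inv_mul_cancel hx (by finiteness), one_mul]

theorem integral_a_condX (hA : S.CondA1) (hx : S.μ {ω | S.X t ω = x} ≠ 0) (φ : NMat n → ℝ) :
    ∫ ω, φ (S.a t ω) ∂S.condX t x = ∫ ω, φ (S.a t ω) ∂S.μ := by
  have hφ : ∀ m : Measure (NMat n), AEStronglyMeasurable φ m := fun m =>
    (measurable_of_countable φ).aestronglyMeasurable
  rw [← integral_map (S.measurable_a t).aemeasurable (hφ _), map_a_condX hA hx,
    integral_map (S.measurable_a t).aemeasurable (hφ _)]

theorem integral_P (hA : S.CondA2) (hx : S.μ {ω | S.X t ω = x} ≠ 0) (φ : NMat n → ℝ) :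
    ∫ y, φ (S.g y) ∂(S.P x).toMeasure = ∫ ω, φ (S.q (t + 1) ω) ∂S.condX t x := by
  rw [← map_X_condX hx, integral_map (S.measurable_X _).aemeasurable
    (measurable_of_countable _).aestronglyMeasurable]
  simp only [hA.1]

theorem queueStep (t : ℕ) (ω : S.Ω) : QueueStep (S.q t ω) (S.a t ω) (S.s t ω) (S.q (t + 1) ω) :=
  ⟨S.isSchedule_s t ω, S.queue_eq t ω⟩

theorem ae_queueStep_condX (hA : S.CondA2) :
    ∀ᵐ ω ∂S.condX t x, QueueStep (S.g x) (S.a t ω) (S.s t ω) (S.q (t + 1) ω) := by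
  filter_upwards [ae_q_condX hA] with ω hω
  exact hω ▸ queueStep t ω

end Chain

/-! ### Moments of the arrivals -/

section Arrivals

theorem integrable_comp_of_le {Ω : Type*} [MeasurableSpace Ω] {n : ℕ} (m : Measure Ω)
    [IsFiniteMeasure m] {Z : Ω → NMat n} (hZ : Measurable Z) {b : NMat n}
    (hb : ∀ᵐ ω ∂m, ∀ i j, Z ω i j ≤ b i j) (φ : NMat n → ℝ) :
    Integrable (fun ω => φ (Z ω)) m := by
  obtain ⟨C, hC⟩ := ((Set.finite_Icc (0 : NMat n) b).image fun M => ‖φ M‖).bddAbove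
  refine Integrable.of_bound (C := C)
    ((measurable_of_countable φ).comp hZ).aestronglyMeasurable ?_
  filter_upwards [hb] with ω hω
  exact hC ⟨Z ω, ⟨fun i j => Nat.zero_le _, fun i j => hω i j⟩, rfl⟩

variable {n : ℕ}

/-- The part of the assumption on the arrivals that concerns the law of each single slot. -/
structure SlotArrivalAssumption (S : SwitchSystem.{u, v} n) (aMax : ℕ) : Prop where
  ident : ∀ i j t, IdentDistrib (fun ω => S.a t ω i j) (fun ω => S.a 0 ω i j) S.μ S.μ
  indep_pairs : ∀ t i j i' j', (i, j) ≠ (i', j') →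
    IndepFun (fun ω => S.a t ω i j) (fun ω => S.a t ω i' j') S.μ
  bounded : ∀ t ω i j, S.a t ω i j ≤ aMax

variable {S : SwitchSystem.{u, v} n} {aMax t : ℕ}

theorem ArrivalAssumption.slotArrivalAssumption (harr : S.ArrivalAssumption aMax) :
    S.SlotArrivalAssumption aMax := ⟨harr.ident, harr.indep_pairs, harr.bounded⟩

theorem integrable_s (m : Measure S.Ω) [IsFiniteMeasure m] (φ : NMat n → ℝ) :
    Integrable (fun ω => φ (S.s t ω)) m :=
  integrable_comp_of_le m (S.measurable_s t) (b := fun _ _ => 1)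
    (Eventually.of_forall fun ω => (S.isSchedule_s t ω).le_one) φ

namespace SlotArrivalAssumption

variable (harr : S.SlotArrivalAssumption aMax)

include harr

theorem integrable_a (m : Measure S.Ω) [IsFiniteMeasure m] (φ : NMat n → ℝ) :
    Integrable (fun ω => φ (S.a t ω)) m :=
  integrable_comp_of_le m (S.measurable_a t) (b := fun _ _ => aMax)
    (Eventually.of_forall fun ω => harr.bounded t ω) φ

theorem integrable_q {x : S.A} (hA : S.CondA2) [IsFiniteMeasure (S.condX t x)] (φ : NMat n → ℝ) :
    Integrable (fun ω => φ (S.q (t + 1) ω)) (S.condX t x) := by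
  refine integrable_comp_of_le _ (S.measurable_q _) (b := fun i j => S.g x i j + aMax) ?_ φ
  filter_upwards [ae_queueStep_condX hA] with ω hω i j
  have hbound := harr.bounded t ω i j
  rw [hω.queue_eq]
  lia

theorem memLp_a (i j : Fin n) : MemLp (fun ω => (S.a t ω i j : ℝ)) 2 S.μ := by
  refine (memLp_two_iff_integrable_sq ?_).2
    (harr.integrable_a S.μ fun M => (M i j : ℝ) ^ 2)
  exact (harr.integrable_a S.μ fun M => (M i j : ℝ)).aestronglyMeasurable

theorem identDistrib_a (i j : Fin n) :
    IdentDistrib (fun ω => (S.a t ω i j : ℝ)) (fun ω => (S.a 0 ω i j : ℝ)) S.μ S.μ :=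
  (harr.ident i j t).comp (u := fun k : ℕ => (k : ℝ)) (measurable_of_countable _)

theorem integral_a (i j : Fin n) : ∫ ω, (S.a t ω i j : ℝ) ∂S.μ = S.rate i j :=
  (harr.identDistrib_a i j).integral_eq

theorem integral_sum_a (F : Finset (Fin n × Fin n)) :
    ∫ ω, ∑ p ∈ F, (S.a t ω p.1 p.2 : ℝ) ∂S.μ = ∑ p ∈ F, S.rate p.1 p.2 := by
  rw [integral_finsetSum _ fun p _ => (harr.memLp_a p.1 p.2).integrable one_le_two]
  exact Finset.sum_congr rfl fun p _ => harr.integral_a _ _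

theorem variance_sum_a (F : Finset (Fin n × Fin n)) :
    variance (fun ω => ∑ p ∈ F, (S.a t ω p.1 p.2 : ℝ)) S.μ = ∑ p ∈ F, S.arrivalVar p.1 p.2 := by
  have hcast : Measurable fun k : ℕ => (k : ℝ) := measurable_of_countable _
  rw [show (fun ω => ∑ p ∈ F, (S.a t ω p.1 p.2 : ℝ)) = ∑ p ∈ F, fun ω => (S.a t ω p.1 p.2 : ℝ) by
      ext ω; rw [Finset.sum_apply],
    IndepFun.variance_sum (fun p _ => harr.memLp_a p.1 p.2) fun p _ p' _ hp =>
      (harr.indep_pairs t p.1 p.2 p'.1 p'.2 hp).comp hcast hcast]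
  exact Finset.sum_congr rfl fun p _ => (harr.identDistrib_a p.1 p.2).variance_eq

theorem integral_sum_a_sub_sq (F : Finset (Fin n × Fin n)) (c : ℝ) :
    ∫ ω, (∑ p ∈ F, (S.a t ω p.1 p.2 : ℝ) - c) ^ 2 ∂S.μ =
      ∑ p ∈ F, S.arrivalVar p.1 p.2 + (∑ p ∈ F, S.rate p.1 p.2 - c) ^ 2 := by
  have hsum : MemLp (fun ω => ∑ p ∈ F, (S.a t ω p.1 p.2 : ℝ)) 2 S.μ :=
    memLp_finsetSum F fun p _ => harr.memLp_a p.1 p.2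
  have hvar := variance_eq_sub (hsum.sub (memLp_const c))
  simp only [Pi.sub_def, Pi.pow_apply] at hvar
  rw [variance_sub_const hsum.aestronglyMeasurable, harr.variance_sum_a,
    integral_sub (hsum.integrable one_le_two) (integrable_const c), harr.integral_sum_a,
    integral_const, probReal_univ, one_smul] at hvar
  linarith

end SlotArrivalAssumption

end Arrivals

end SwitchSystem

/-! ### Drift of the queue lengths -/

namespace SwitchSystem

variable {n : ℕ}

/-- Arrivals with mean `(1 - ε) ν`, where all row and column sums of `ν` are `1`. -/
structure LoadAssumption (S : SwitchSystem.{u, v} n) (aMax : ℕ) (ν : Matrix (Fin n) (Fin n) ℝ)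
    (ε : ℝ) : Prop extends S.SlotArrivalAssumption aMax where
  unitSums : UnitSums (vec ν)
  rate_eq : ∀ i j, S.rate i j = (1 - ε) * ν i j

/-- The inequality that defines the class `Π₁(ν)`, for a single switch and the constant `W`. -/
def DriftCondition (S : SwitchSystem.{u, v} n) (ν : Matrix (Fin n) (Fin n) ℝ) (W : ℝ) : Prop :=
  ∀ (t : ℕ) (x : S.A), S.μ {ω | S.X t ω = x} ≠ 0 →
    inner ℝ (natVec (S.g x)) (vec ν) + W * ‖perpK (natVec (S.g x))‖ ≤
      ∫ ω, inner ℝ (natVec (S.q t ω)) (natVec (S.s t ω)) ∂S.condX t x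

variable {S : SwitchSystem.{u, v} n} {ν : Matrix (Fin n) (Fin n) ℝ} {aMax t : ℕ} {ε W : ℝ}
  {x : S.A}

theorem DriftCondition.le_integral_inner (hW : S.DriftCondition ν W) (hA : S.CondA2)
    (hx : S.μ {ω | S.X t ω = x} ≠ 0) :
    inner ℝ (natVec (S.g x)) (vec ν) + W * ‖perpK (natVec (S.g x))‖ ≤
      ∫ ω, inner ℝ (natVec (S.g x)) (natVec (S.s t ω)) ∂S.condX t x := by
  refine (hW t x hx).trans_eq (integral_congr_ae ?_)
  filter_upwards [ae_q_condX hA] with ω hω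
  rw [hω]

namespace LoadAssumption

variable (hload : S.LoadAssumption aMax ν ε)

include hload

theorem integral_inner_a (c : Vec n) :
    ∫ ω, inner ℝ c (natVec (S.a t ω)) ∂S.μ = (1 - ε) * inner ℝ c (vec ν) := by
  simp only [inner_eq_sum, natVec_apply, Finset.mul_sum]
  rw [integral_finsetSum _ fun i _ =>
    hload.integrable_a _ fun M => ∑ j, c (i, j) * (M i j : ℝ)]
  refine Finset.sum_congr rfl fun i _ => ?_
  rw [integral_finsetSum _ fun j _ => hload.integrable_a _ fun M => c (i, j) * (M i j : ℝ)]
  refine Finset.sum_congr rfl fun j _ => ?_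
  rw [integral_const_mul, hload.integral_a, hload.rate_eq, mul_left_comm]
  rfl

theorem integral_total_a : ∫ ω, total (natVec (S.a t ω)) ∂S.μ = (1 - ε) * n := by
  have htotal (y : Vec n) : total y = inner ℝ (vec fun _ _ => 1) y := by
    simp only [inner_eq_sum, total, vec_apply, one_mul]
  simp only [htotal (natVec _)]
  rw [hload.integral_inner_a, ← htotal, hload.unitSums.total_eq]

theorem integral_norm_sub_sq_le (hA₁ : S.CondA1) (hA₂ : S.CondA2) (hW : S.DriftCondition ν W)
    (hx : S.μ {ω | S.X t ω = x} ≠ 0) {p : Vec n} (hp : p ∈ coneK n) :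
    ∫ ω, ‖natVec (S.q (t + 1) ω) - p‖ ^ 2 ∂S.condX t x ≤ ‖natVec (S.g x) - p‖ ^ 2 -
      2 * (ε * inner ℝ (natVec (S.g x) - p) (vec ν) + W * ‖perpK (natVec (S.g x))‖) +
      (n * (aMax + 1)) ^ 2 := by
  have := cond_isProbabilityMeasure hx
  set Q := natVec (S.g x)
  have hIa : Integrable (fun ω => inner ℝ (Q - p) (natVec (S.a t ω))) (S.condX t x) :=
    hload.integrable_a _ fun M => inner ℝ (Q - p) (natVec M)
  have hIs : Integrable (fun ω => inner ℝ Q (natVec (S.s t ω))) (S.condX t x) :=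
    integrable_s _ fun M => inner ℝ Q (natVec M)
  have hservice : inner ℝ Q (vec ν) + W * ‖perpK Q‖ ≤
      ∫ ω, inner ℝ Q (natVec (S.s t ω)) ∂S.condX t x := hW.le_integral_inner hA₂ hx
  calc ∫ ω, ‖natVec (S.q (t + 1) ω) - p‖ ^ 2 ∂S.condX t x
      ≤ ∫ ω, (‖Q - p‖ ^ 2 + 2 * (inner ℝ (Q - p) (natVec (S.a t ω)) -
          inner ℝ Q (natVec (S.s t ω)) + inner ℝ p (vec ν)) + (n * (aMax + 1)) ^ 2)
          ∂S.condX t x := by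
        refine integral_mono_ae (hload.integrable_q hA₂ fun M => ‖natVec M - p‖ ^ 2)
          (by fun_prop) ?_
        filter_upwards [ae_queueStep_condX hA₂] with ω hω
        exact hω.norm_nextQueue_sub_sq_le (hload.bounded t ω) hload.unitSums hp
    _ = ‖Q - p‖ ^ 2 + 2 * ((1 - ε) * inner ℝ (Q - p) (vec ν) -
          ∫ ω, inner ℝ Q (natVec (S.s t ω)) ∂S.condX t x + inner ℝ p (vec ν)) +
          (n * (aMax + 1)) ^ 2 := by
        rw [integral_add (by fun_prop) (by fun_prop), integral_add (by fun_prop) (by fun_prop),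
          integral_const_mul, integral_add (by fun_prop) (by fun_prop), integral_sub hIa hIs,
          integral_a_condX hA₁ hx fun M => inner ℝ (Q - p) (natVec M), hload.integral_inner_a]
        simp only [integral_const, probReal_univ, one_smul]
    _ ≤ _ := by
        rw [inner_sub_left]
        linarith

theorem integral_norm_sq_le (hA₁ : S.CondA1) (hA₂ : S.CondA2) (hW : S.DriftCondition ν W)
    (hε : 0 ≤ ε) (hW₀ : 0 ≤ W) {κ : ℝ} (hκ₀ : 0 ≤ κ) (hκ : ∀ i j, κ ≤ ν i j)
    (hx : S.μ {ω | S.X t ω = x} ≠ 0) :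
    ∫ ω, ‖natVec (S.q (t + 1) ω)‖ ^ 2 ∂S.condX t x ≤ ‖natVec (S.g x)‖ ^ 2 -
      2 * (ε * κ) * ‖natVec (S.g x)‖ + (n * (aMax + 1)) ^ 2 := by
  have hdrift := hload.integral_norm_sub_sq_le hA₁ hA₂ hW hx zero_mem_coneK
  simp only [sub_zero] at hdrift
  have hinner : κ * ‖natVec (S.g x)‖ ≤ inner ℝ (natVec (S.g x)) (vec ν) :=
    calc κ * ‖natVec (S.g x)‖ ≤ κ * total (natVec (S.g x)) :=
          mul_le_mul_of_nonneg_left (norm_le_total (natVec_nonneg _)) hκ₀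
      _ = ∑ i, ∑ j, natVec (S.g x) (i, j) * κ := by
          simp only [total, ← Finset.sum_mul, mul_comm κ]
      _ ≤ inner ℝ (natVec (S.g x)) (vec ν) := by
          rw [inner_eq_sum]
          exact Finset.sum_le_sum fun i _ => Finset.sum_le_sum fun j _ =>
            mul_le_mul_of_nonneg_left (hκ i j) (natVec_nonneg _ _)
  have hcollapse : 0 ≤ W * ‖perpK (natVec (S.g x))‖ := by positivity
  linarith [mul_le_mul_of_nonneg_left hinner hε]

theorem integral_norm_perpK_sq_le (hA₁ : S.CondA1) (hA₂ : S.CondA2) (hW : S.DriftCondition ν W)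
    (hε : 0 ≤ ε) (hεW : ε * ‖vec ν‖ ≤ W / 2) (hx : S.μ {ω | S.X t ω = x} ≠ 0) :
    ∫ ω, ‖perpK (natVec (S.q (t + 1) ω))‖ ^ 2 ∂S.condX t x ≤ ‖perpK (natVec (S.g x))‖ ^ 2 -
      2 * (W / 2) * ‖perpK (natVec (S.g x))‖ + (n * (aMax + 1)) ^ 2 := by
  have := cond_isProbabilityMeasure hx
  have hp := projK_mem (natVec (S.g x))
  have hnearest : ∫ ω, ‖perpK (natVec (S.q (t + 1) ω))‖ ^ 2 ∂S.condX t x ≤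
      ∫ ω, ‖natVec (S.q (t + 1) ω) - projK (natVec (S.g x))‖ ^ 2 ∂S.condX t x :=
    integral_mono (hload.integrable_q hA₂ fun M => ‖perpK (natVec M)‖ ^ 2)
      (hload.integrable_q hA₂ fun M => ‖natVec M - projK (natVec (S.g x))‖ ^ 2)
      fun ω => pow_le_pow_left₀ (norm_nonneg _) (norm_perpK_le hp) 2
  have hdrift := hload.integral_norm_sub_sq_le hA₁ hA₂ hW hx hp
  rw [← perpK] at hdrift
  have hinner : -(‖perpK (natVec (S.g x))‖ * ‖vec ν‖) ≤
      inner ℝ (perpK (natVec (S.g x))) (vec ν) := (abs_le.1 (abs_real_inner_le_norm _ _)).1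
  linarith [mul_le_mul_of_nonneg_left hinner hε,
    mul_le_mul_of_nonneg_right hεW (norm_nonneg (perpK (natVec (S.g x))))]

end LoadAssumption

theorem tsum_P_mul_ofReal (harr : S.SlotArrivalAssumption aMax) (hA : S.CondA2)
    (hx : S.μ {ω | S.X t ω = x} ≠ 0) {φ : NMat n → ℝ} (hφ : ∀ M, 0 ≤ φ M) :
    ∑' y, S.P x y * ENNReal.ofReal (φ (S.g y)) =
      ENNReal.ofReal (∫ ω, φ (S.q (t + 1) ω) ∂S.condX t x) := by
  have := cond_isProbabilityMeasure hx
  rw [← lintegral_toMeasure, ofReal_integral_eq_lintegral_ofReal (harr.integrable_q hA φ)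
    (.of_forall fun ω => hφ _), ← map_X_condX hx,
    lintegral_map (measurable_of_countable _) (S.measurable_X _)]
  simp only [hA.1]

theorem geometricDrift_expLyapunov (harr : S.SlotArrivalAssumption aMax) (hirr : Irreducible S.P)
    (hA : S.CondA2) {D η C θ : ℝ} (hη : 0 < η) (hηD : η ≤ D) (hD : n * (aMax + 1) ≤ D)
    (hC : 0 ≤ C) (hθ : 0 < θ) (hθD : θ * D ≤ 1) (hθη : 4 * θ * D ^ 2 ≤ η) {F : NMat n → ℝ}
    (hF : ∀ M M', |F M - F M'| ≤ ‖natVec M - natVec M'‖)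
    (hdrift : ∀ t x, S.μ {ω | S.X t ω = x} ≠ 0 →
      ∫ ω, F (S.q (t + 1) ω) ^ 2 ∂S.condX t x ≤ F (S.g x) ^ 2 - 2 * η * F (S.g x) + C) :
    GeometricDrift S.P (expLyapunov θ fun x => F (S.g x)) (1 - θ * η / 4).toNNReal
      (Real.exp (θ * (C / η + D))).toNNReal where
  lt_one := by
    rw [Real.toNNReal_lt_one]
    linarith [mul_pos hθ hη]
  tsum_le x := by
    obtain ⟨t, hx⟩ := S.exists_measure_X_ne_zero hirr x
    have := cond_isProbabilityMeasure hx
    have hθη1 : θ * η ≤ 1 := (mul_le_mul_of_nonneg_left hηD hθ.le).trans hθD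
    have hjump : ∀ᵐ ω ∂S.condX t x, |F (S.q (t + 1) ω) - F (S.g x)| ≤ D := by
      filter_upwards [ae_queueStep_condX hA] with ω hω
      exact (hF _ _).trans ((hω.norm_nextQueue_sub_queue_le (harr.bounded t ω)).trans hD)
    have hexp := integral_exp_mul_le hθ.le hη hηD hθD hθη hC
      ((measurable_of_countable F).comp (S.measurable_q (t + 1))).aemeasurable hjump
      (hdrift t x hx)
    calc ∑' y, S.P x y * (expLyapunov θ (fun x => F (S.g x)) y : ENNReal)
        = ENNReal.ofReal (∫ ω, Real.exp (θ * F (S.q (t + 1) ω)) ∂S.condX t x) :=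
          tsum_P_mul_ofReal harr hA hx (φ := fun M => Real.exp (θ * F M))
            fun M => Real.exp_nonneg _
      _ ≤ _ := ENNReal.ofReal_le_ofReal hexp
      _ = _ := by
          rw [ENNReal.ofReal_add (mul_nonneg (by linarith) (Real.exp_nonneg _))
            (Real.exp_nonneg _), ENNReal.ofReal_mul (by linarith)]
          rfl

theorem exists_geometricDrift (n aMax : ℕ) {η C : ℝ} (hη : 0 < η) (hC : 0 ≤ C) :
    ∃ θ : ℝ, 0 < θ ∧ ∃ γ K : NNReal, ∀ S : SwitchSystem.{u, v} n,
      S.SlotArrivalAssumption aMax → Irreducible S.P → S.CondA2 → ∀ F : NMat n → ℝ,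
      (∀ M M', |F M - F M'| ≤ ‖natVec M - natVec M'‖) →
      (∀ t x, S.μ {ω | S.X t ω = x} ≠ 0 →
        ∫ ω, F (S.q (t + 1) ω) ^ 2 ∂S.condX t x ≤ F (S.g x) ^ 2 - 2 * η * F (S.g x) + C) →
      GeometricDrift S.P (expLyapunov θ fun x => F (S.g x)) γ K := by
  obtain ⟨θ, hθ, hθD, hθη⟩ := exists_expRate hη (le_max_right (n * (aMax + 1) : ℝ) η)
  exact ⟨θ, hθ, _, _, fun S harr hirr hA F hF hdrift => geometricDrift_expLyapunov harr hirr hA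
    hη (le_max_right _ _) (le_max_left _ _) hC hθ hθD hθη hF hdrift⟩

/-! ### The steady state -/

theorem LoadAssumption.exists_geometricDrift_norm (hload : S.LoadAssumption aMax ν ε)
    (hA₁ : S.CondA1) (hA₂ : S.CondA2) (hν : ∀ i j, 0 < ν i j) (hε : 0 < ε) (hW₀ : 0 ≤ W)
    (hW : S.DriftCondition ν W) : ∃ θ : ℝ, 0 < θ ∧ ∃ γ K : NNReal,
      GeometricDrift S.P (expLyapunov θ fun x => ‖natVec (S.g x)‖) γ K := by
  obtain ⟨κ, hκ₀, hκ⟩ : ∃ κ : ℝ, 0 < κ ∧ ∀ i j, κ ≤ ν i j := by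
    rcases isEmpty_or_nonempty (Fin n × Fin n) with hempty | hnonempty
    · exact ⟨1, one_pos, fun i j => hempty.elim (i, j)⟩
    · obtain ⟨p, hp⟩ := Finite.exists_min fun p : Fin n × Fin n => ν p.1 p.2
      exact ⟨_, hν p.1 p.2, fun i j => hp (i, j)⟩
  obtain ⟨θ, hθ, γ, K, hdrift⟩ := exists_geometricDrift.{u, v} n aMax (mul_pos hε hκ₀)
    (sq_nonneg (n * (aMax + 1) : ℝ))
  exact ⟨θ, hθ, γ, K, hdrift S hload.toSlotArrivalAssumption hA₁.2.1 hA₂ (fun M => ‖natVec M‖)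
    (fun _ _ => abs_norm_sub_norm_le _ _)
    fun _ _ hx => hload.integral_norm_sq_le hA₁ hA₂ hW hε.le hW₀ hκ₀.le hκ hx⟩

theorem finite_norm_natVec_g_le (hA : S.CondA2) (c : ℝ) : {x | ‖natVec (S.g x)‖ ≤ c}.Finite :=
  hA.2 _ (finite_natVec_norm_le c)

theorem LoadAssumption.stable (hload : S.LoadAssumption aMax ν ε) (hA₁ : S.CondA1)
    (hA₂ : S.CondA2) (hν : ∀ i j, 0 < ν i j) (hε : 0 < ε) (hW₀ : 0 ≤ W)
    (hW : S.DriftCondition ν W) : S.Stable := by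
  obtain ⟨θ, hθ, γ, K, hdrift⟩ := hload.exists_geometricDrift_norm hA₁ hA₂ hν hε hW₀ hW
  exact hdrift.positiveRecurrent (finite_expLyapunov_le hθ (finite_norm_natVec_g_le hA₂))
    hA₁.2.1 hA₁.2.2

theorem LoadAssumption.exists_isLimitLaw (hload : S.LoadAssumption aMax ν ε) (hA₁ : S.CondA1)
    (hA₂ : S.CondA2) (hν : ∀ i j, 0 < ν i j) (hε : 0 < ε) (hW₀ : 0 ≤ W)
    (hW : S.DriftCondition ν W) : ∃ π, IsLimitLaw S.P π ∧
      ∀ r : ℕ, Integrable (fun y => ‖natVec (S.g y)‖ ^ r) π.toMeasure := by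
  obtain ⟨θ, hθ, γ, K, hdrift⟩ := hload.exists_geometricDrift_norm hA₁ hA₂ hν hε hW₀ hW
  have : Nonempty S.A := ⟨S.initDist.support_nonempty.some⟩
  obtain ⟨π, hπ⟩ := hdrift.exists_isLimitLaw
    (finite_expLyapunov_le hθ (finite_norm_natVec_g_le hA₂)) hA₁.2.1 hA₁.2.2
  exact ⟨π, hπ, hπ.integrable_pow hdrift hθ fun _ => norm_nonneg _⟩

theorem exists_integral_norm_perpK_pow_le (n aMax : ℕ) (hW₀ : 0 < W) :
    ∃ C : ℕ → ℝ, ∀ (S : SwitchSystem.{u, v} n) (ν : Matrix (Fin n) (Fin n) ℝ) (ε : ℝ),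
      S.LoadAssumption aMax ν ε → S.CondA1 → S.CondA2 → 0 ≤ ε → ε * ‖vec ν‖ ≤ W / 2 →
      S.DriftCondition ν W → ∀ π : PMF S.A, IsLimitLaw S.P π → ∀ r : ℕ,
      ∫ y, ‖perpK (natVec (S.g y))‖ ^ r ∂π.toMeasure ≤ C r := by
  obtain ⟨θ, hθ, γ, K, hdrift⟩ := exists_geometricDrift.{u, v} n aMax (half_pos hW₀)
    (sq_nonneg (n * (aMax + 1) : ℝ))
  refine ⟨fun r => r.factorial / θ ^ r * (K / (1 - γ) : NNReal),
    fun S ν ε hload hA₁ hA₂ hε hεW hW π hπ =>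
      hπ.integral_pow_le (hdrift S hload.toSlotArrivalAssumption hA₁.2.1 hA₂
        (fun M => ‖perpK (natVec M)‖) (fun _ _ => abs_norm_perpK_sub_le _ _) ?_) hθ
        fun _ => norm_nonneg _⟩
  exact fun _ _ hx => hload.integral_norm_perpK_sq_le hA₁ hA₂ hW hε hεW hx

/-- The law of the queue lengths under a distribution of the state. -/
def queueLaw (S : SwitchSystem.{u, v} n) (π : PMF S.A) : ProbabilityMeasure (NMat n) :=
  ⟨π.toMeasure.map S.g, Measure.isProbabilityMeasure_map (measurable_of_countable _).aemeasurable⟩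

theorem integral_queueLaw (π : PMF S.A) (φ : NMat n → ℝ) :
    ∫ M, φ M ∂(S.queueLaw π : Measure (NMat n)) = ∫ y, φ (S.g y) ∂π.toMeasure :=
  integral_map (measurable_of_countable _).aemeasurable
    (measurable_of_countable φ).aestronglyMeasurable

theorem integrable_queueLaw {π : PMF S.A} {φ : NMat n → ℝ}
    (hφ : Integrable (fun y => φ (S.g y)) π.toMeasure) :
    Integrable φ (S.queueLaw π : Measure (NMat n)) :=
  (integrable_map_measure (measurable_of_countable φ).aestronglyMeasurable
    (measurable_of_countable _).aemeasurable).2 hφ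

theorem measure_q_preimage (hA : S.CondA2) (t : ℕ) (G : Set (NMat n)) :
    S.μ (S.q t ⁻¹' G) =
      ∑' x, S.initDist x * stepExp S.P t ((S.g ⁻¹' G).indicator 1) x := by
  have hpreimage : S.q t ⁻¹' G = S.X t ⁻¹' (S.g ⁻¹' G) := by
    ext ω
    simp only [Set.mem_preimage, hA.1]
  simp only [stepExp]
  rw [← tsum_bind_mul, ← lintegral_toMeasure, lintegral_indicator_one MeasurableSet.of_discrete,
    ← map_X, Measure.map_apply (S.measurable_X t) MeasurableSet.of_discrete, hpreimage]

theorem isSteadyState_queueLaw (hA : S.CondA2) {π : PMF S.A} (hπ : IsLimitLaw S.P π) :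
    S.IsSteadyState (S.queueLaw π) := by
  classical
  refine ⟨fun t => (S.measurable_q t).aemeasurable, aemeasurable_id, ?_⟩
  refine tendsto_of_forall_isOpen_le_liminf' fun G hG => ?_
  have hfatou := hπ.tsum_le_liminf_stepExp S.initDist (f := (S.g ⁻¹' G).indicator 1)
    fun y => by by_cases hy : y ∈ S.g ⁻¹' G <;> simp [hy]
  simp only [← measure_q_preimage hA] at hfatou
  rw [← lintegral_toMeasure, lintegral_indicator_one MeasurableSet.of_discrete] at hfatou
  have hlimit : (Measure.map id (S.queueLaw π : Measure (NMat n))) G =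
      π.toMeasure (S.g ⁻¹' G) := by
    rw [Measure.map_id]
    exact Measure.map_apply (measurable_of_countable _) hG.measurableSet
  have hlaw (t : ℕ) : (S.μ.map (S.q t)) G = S.μ (S.q t ⁻¹' G) :=
    Measure.map_apply (S.measurable_q t) hG.measurableSet
  simpa only [ProbabilityMeasure.coe_mk, hlimit, hlaw] using hfatou

end SwitchSystem

/-! ### The projected queue lengths in steady state -/

theorem UnitSums.norm_starProjection_natVec_sub_sq {n : ℕ} {x : Vec n} (hx : UnitSums x)
    (M : NMat n) : ‖(spaceS n).starProjection (natVec M - x)‖ ^ 2 =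
      (∑ i, (∑ j, (M i j : ℝ) - 1) ^ 2) / n + (∑ j, (∑ i, (M i j : ℝ) - 1) ^ 2) / n -
        (∑ i, ∑ j, (M i j : ℝ) - n) ^ 2 / n ^ 2 := by
  simp only [norm_starProjection_spaceS_sq, total, PiLp.sub_apply, natVec_apply,
    Finset.sum_sub_distrib, hx.1, hx.2, Finset.sum_const, Finset.card_univ,
    Fintype.card_fin, nsmul_eq_mul, mul_one]

namespace SwitchSystem

variable {n : ℕ}

/-- The second moment of `‖P(a - ν)‖`, where `a` are the arrivals of one slot, with mean
`(1 - ε) ν`, and `P` is the projection onto `𝒮`. -/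
def arrivalNoise (S : SwitchSystem.{u, v} n) (ε : ℝ) : ℝ :=
  (2 * n - 1) / n ^ 2 * ∑ i, ∑ j, S.arrivalVar i j + ε ^ 2

variable {S : SwitchSystem.{u, v} n} {ν : Matrix (Fin n) (Fin n) ℝ} {aMax t : ℕ} {ε δ W : ℝ}
  {x : S.A}

namespace LoadAssumption

variable (hload : S.LoadAssumption aMax ν ε)

include hload

theorem sum_rate_row (i : Fin n) : ∑ j, S.rate i j = 1 - ε := by
  have hrow : ∑ j, ν i j = 1 := hload.unitSums.1 i
  simp only [hload.rate_eq, ← Finset.mul_sum, hrow, mul_one]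

theorem sum_rate_col (j : Fin n) : ∑ i, S.rate i j = 1 - ε := by
  have hcol : ∑ i, ν i j = 1 := hload.unitSums.2 j
  simp only [hload.rate_eq, ← Finset.mul_sum, hcol, mul_one]

theorem integral_row_sub_one_sq (i : Fin n) :
    ∫ ω, (∑ j, (S.a t ω i j : ℝ) - 1) ^ 2 ∂S.μ = ∑ j, S.arrivalVar i j + ε ^ 2 := by
  have hmoment := hload.integral_sum_a_sub_sq (t := t) ({i} ×ˢ Finset.univ) 1
  simp only [Finset.sum_product, Finset.sum_singleton, hload.sum_rate_row] at hmoment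
  rw [hmoment]
  ring

theorem integral_col_sub_one_sq (j : Fin n) :
    ∫ ω, (∑ i, (S.a t ω i j : ℝ) - 1) ^ 2 ∂S.μ = ∑ i, S.arrivalVar i j + ε ^ 2 := by
  have hmoment := hload.integral_sum_a_sub_sq (t := t) (Finset.univ ×ˢ {j}) 1
  simp only [Finset.sum_product, Finset.sum_singleton, hload.sum_rate_col] at hmoment
  rw [hmoment]
  ring

theorem integral_total_sub_sq : ∫ ω, (∑ i, ∑ j, (S.a t ω i j : ℝ) - n) ^ 2 ∂S.μ =
    ∑ i, ∑ j, S.arrivalVar i j + (n * ε) ^ 2 := by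
  have hmoment := hload.integral_sum_a_sub_sq (t := t) (Finset.univ ×ˢ Finset.univ) n
  simp only [Finset.sum_product, hload.sum_rate_row, Finset.sum_const, Finset.card_univ,
    Fintype.card_fin, nsmul_eq_mul] at hmoment
  rw [hmoment]
  ring

theorem integral_norm_starProjection_a_sub_sq (hn : 0 < n) :
    ∫ ω, ‖(spaceS n).starProjection (natVec (S.a t ω) - vec ν)‖ ^ 2 ∂S.μ =
      S.arrivalNoise ε := by
  have hI (φ : NMat n → ℝ) : Integrable (fun ω => φ (S.a t ω)) S.μ := hload.integrable_a _ φ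
  have hrows : Integrable (fun ω => (∑ i, (∑ j, (S.a t ω i j : ℝ) - 1) ^ 2) / (n : ℝ)) S.μ :=
    hI fun M => (∑ i, (∑ j, (M i j : ℝ) - 1) ^ 2) / (n : ℝ)
  have hcols : Integrable (fun ω => (∑ j, (∑ i, (S.a t ω i j : ℝ) - 1) ^ 2) / (n : ℝ)) S.μ :=
    hI fun M => (∑ j, (∑ i, (M i j : ℝ) - 1) ^ 2) / (n : ℝ)
  have htotal : Integrable (fun ω => (∑ i, ∑ j, (S.a t ω i j : ℝ) - n) ^ 2 / (n : ℝ) ^ 2) S.μ :=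
    hI fun M => (∑ i, ∑ j, (M i j : ℝ) - n) ^ 2 / (n : ℝ) ^ 2
  simp only [hload.unitSums.norm_starProjection_natVec_sub_sq]
  rw [integral_sub (hrows.fun_add hcols) htotal, integral_add hrows hcols,
    integral_div, integral_div, integral_div,
    integral_finsetSum _ fun i _ => hI fun M => (∑ j, (M i j : ℝ) - 1) ^ 2,
    integral_finsetSum _ fun j _ => hI fun M => (∑ i, (M i j : ℝ) - 1) ^ 2,
    hload.integral_total_sub_sq]
  simp only [hload.integral_row_sub_one_sq, hload.integral_col_sub_one_sq,
    Finset.sum_add_distrib, Finset.sum_const, Finset.card_univ, Fintype.card_fin, nsmul_eq_mul]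
  rw [Finset.sum_comm (f := fun j i => S.arrivalVar i j), arrivalNoise]
  field_simp
  ring

theorem integral_projectionResidual (hn : 0 < n) (hA₁ : S.CondA1) (hA₂ : S.CondA2)
    (hx : S.μ {ω | S.X t ω = x} ≠ 0) :
    ∫ ω, projectionResidual ν (S.g x) (S.a t ω) (S.q (t + 1) ω) ∂S.condX t x =
      ∫ ω, ‖(spaceS n).starProjection (natVec (S.q (t + 1) ω))‖ ^ 2 ∂S.condX t x -
        ‖(spaceS n).starProjection (natVec (S.g x))‖ ^ 2 +
        2 * ε / n * total (natVec (S.g x)) - S.arrivalNoise ε := by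
  have := cond_isProbabilityMeasure hx
  set Pg := (spaceS n).starProjection (natVec (S.g x))
  have hnext : Integrable (fun ω => ‖(spaceS n).starProjection (natVec (S.q (t + 1) ω))‖ ^ 2)
      (S.condX t x) := hload.integrable_q hA₂ fun M => ‖(spaceS n).starProjection (natVec M)‖ ^ 2
  have hinner : Integrable (fun ω => inner ℝ Pg (natVec (S.a t ω))) (S.condX t x) :=
    hload.integrable_a _ fun M => inner ℝ Pg (natVec M)
  have hnoise : Integrable
      (fun ω => ‖(spaceS n).starProjection (natVec (S.a t ω) - vec ν)‖ ^ 2) (S.condX t x) :=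
    hload.integrable_a _ fun M => ‖(spaceS n).starProjection (natVec M - vec ν)‖ ^ 2
  simp only [projectionResidual]
  rw [integral_sub (by fun_prop) hnoise, integral_sub (by fun_prop) (by fun_prop),
    integral_sub hnext (by fun_prop), integral_const_mul, integral_sub hinner (by fun_prop),
    integral_a_condX hA₁ hx fun M => inner ℝ Pg (natVec M), hload.integral_inner_a,
    hload.unitSums.inner_starProjection,
    integral_a_condX hA₁ hx fun M => ‖(spaceS n).starProjection (natVec M - vec ν)‖ ^ 2,
    hload.integral_norm_starProjection_a_sub_sq hn]
  simp only [integral_const, probReal_univ, one_smul]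
  ring

theorem integral_abs_projectionResidual_le (hA₁ : S.CondA1) (hA₂ : S.CondA2) (hδ : 0 < δ)
    (hx : S.μ {ω | S.X t ω = x} ≠ 0) :
    ∫ ω, |projectionResidual ν (S.g x) (S.a t ω) (S.q (t + 1) ω)| ∂S.condX t x ≤
      δ * ∫ ω, ‖perpK (natVec (S.q (t + 1) ω))‖ ^ 2 ∂S.condX t x + (1 / δ + 1) *
        (∫ ω, total (natVec (S.q (t + 1) ω)) ∂S.condX t x - total (natVec (S.g x)) +
          ε * n) := by
  have := cond_isProbabilityMeasure hx
  have hperp : Integrable (fun ω => ‖perpK (natVec (S.q (t + 1) ω))‖ ^ 2) (S.condX t x) :=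
    hload.integrable_q hA₂ fun M => ‖perpK (natVec M)‖ ^ 2
  have hnext : Integrable (fun ω => total (natVec (S.q (t + 1) ω))) (S.condX t x) :=
    hload.integrable_q hA₂ fun M => total (natVec M)
  have harrival : Integrable (fun ω => total (natVec (S.a t ω))) (S.condX t x) :=
    hload.integrable_a _ fun M => total (natVec M)
  calc ∫ ω, |projectionResidual ν (S.g x) (S.a t ω) (S.q (t + 1) ω)| ∂S.condX t x
      ≤ ∫ ω, (δ * ‖perpK (natVec (S.q (t + 1) ω))‖ ^ 2 + (1 / δ + 1) *
          (total (natVec (S.q (t + 1) ω)) - total (natVec (S.g x)) -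
            total (natVec (S.a t ω)) + n)) ∂S.condX t x := by
        refine integral_mono_of_nonneg (.of_forall fun ω => abs_nonneg _) (by fun_prop) ?_
        filter_upwards [ae_queueStep_condX hA₂] with ω hω
        exact hω.abs_projectionResidual_le hload.unitSums hδ
    _ = _ := by
        rw [integral_add (by fun_prop) (by fun_prop), integral_const_mul, integral_const_mul,
          integral_add (by fun_prop) (by fun_prop), integral_sub (by fun_prop) harrival,
          integral_sub hnext (by fun_prop),
          integral_a_condX hA₁ hx fun M => total (natVec M), hload.integral_total_a]
        simp only [integral_const, probReal_univ, one_smul]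
        ring

theorem abs_drift_norm_starProjection_sq_le (hn : 0 < n) (hA₁ : S.CondA1) (hA₂ : S.CondA2)
    (hδ : 0 < δ) (x : S.A) :
    |∫ y, ‖(spaceS n).starProjection (natVec (S.g y))‖ ^ 2 ∂(S.P x).toMeasure -
        ‖(spaceS n).starProjection (natVec (S.g x))‖ ^ 2 +
        2 * ε / n * total (natVec (S.g x)) - S.arrivalNoise ε| ≤
      δ * ∫ y, ‖perpK (natVec (S.g y))‖ ^ 2 ∂(S.P x).toMeasure + (1 / δ + 1) *
        (∫ y, total (natVec (S.g y)) ∂(S.P x).toMeasure - total (natVec (S.g x)) + ε * n) := by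
  obtain ⟨t, hx⟩ := S.exists_measure_X_ne_zero hA₁.2.1 x
  rw [integral_P hA₂ hx fun M => ‖(spaceS n).starProjection (natVec M)‖ ^ 2,
    integral_P hA₂ hx fun M => ‖perpK (natVec M)‖ ^ 2,
    integral_P hA₂ hx fun M => total (natVec M),
    ← hload.integral_projectionResidual hn hA₁ hA₂ hx]
  exact abs_integral_le_integral_abs.trans (hload.integral_abs_projectionResidual_le hA₁ hA₂ hδ hx)

end LoadAssumption

section SteadyState

variable {π : PMF S.A} (hmom : ∀ r : ℕ, Integrable (fun y => ‖natVec (S.g y)‖ ^ r) π.toMeasure)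

include hmom

theorem integrable_total : Integrable (fun y => total (natVec (S.g y))) π.toMeasure := by
  refine ((hmom 1).const_mul ((n : ℝ) ^ 2)).mono'
    (measurable_of_countable _).aestronglyMeasurable (.of_forall fun y => ?_)
  rw [Real.norm_of_nonneg ((norm_nonneg _).trans (norm_le_total (natVec_nonneg _))), pow_one]
  exact total_le_norm _

theorem integrable_norm_perpK_pow (r : ℕ) :
    Integrable (fun y => ‖perpK (natVec (S.g y))‖ ^ r) π.toMeasure := by
  refine (hmom r).mono' (measurable_of_countable _).aestronglyMeasurable (.of_forall fun y => ?_)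
  rw [Real.norm_of_nonneg (by positivity)]
  exact pow_le_pow_left₀ (norm_nonneg _) (norm_perpK_le_norm _) r

theorem integrable_norm_starProjection_sq :
    Integrable (fun y => ‖(spaceS n).starProjection (natVec (S.g y))‖ ^ 2) π.toMeasure := by
  refine (hmom 2).mono' (measurable_of_countable _).aestronglyMeasurable (.of_forall fun y => ?_)
  rw [Real.norm_of_nonneg (by positivity)]
  exact pow_le_pow_left₀ (norm_nonneg _) ((spaceS n).norm_starProjection_apply_le _) 2

theorem LoadAssumption.abs_integral_total_sub_arrivalNoise_le (hload : S.LoadAssumption aMax ν ε)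
    (hn : 0 < n) (hA₁ : S.CondA1) (hA₂ : S.CondA2) (hδ : 0 < δ) (hπ : π.bind S.P = π) :
    |2 * ε / n * ∫ y, total (natVec (S.g y)) ∂π.toMeasure - S.arrivalNoise ε| ≤
      δ * ∫ y, ‖perpK (natVec (S.g y))‖ ^ 2 ∂π.toMeasure + (1 / δ + 1) * (ε * n) :=
  abs_const_mul_integral_sub_le_of_abs_drift_le hπ (integrable_norm_starProjection_sq hmom)
    (integrable_total hmom) (integrable_norm_perpK_pow hmom 2)
    (hload.abs_drift_norm_starProjection_sq_le hn hA₁ hA₂ hδ)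

end SteadyState

end SwitchSystem

/-! ### The heavy-traffic limit -/

/-- The estimate is the one for `δ = √ε`, for which both error terms vanish as `ε ↓ 0`. -/
theorem tendsto_mul_of_abs_sub_le {n : ℕ} (hn : 0 < n) {m v : ℝ → ℝ} {s C ε₀ : ℝ} (hε₀ : 0 < ε₀)
    (hv : Tendsto v (𝓝[>] 0) (𝓝 s))
    (hm : ∀ ε, 0 < ε → ε ≤ ε₀ → |2 * ε / n * m ε - ((2 * n - 1) / (n : ℝ) ^ 2 * v ε + ε ^ 2)| ≤
      √ε * C + (1 / √ε + 1) * (ε * n)) :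
    Tendsto (fun ε => ε * m ε) (𝓝[>] 0) (𝓝 ((1 - 1 / (2 * (n : ℝ))) * s)) := by
  have hid : Tendsto (fun ε : ℝ => ε) (𝓝[>] 0) (𝓝 0) := tendsto_id.mono_left nhdsWithin_le_nhds
  have hsqrt : Tendsto (fun ε : ℝ => √ε) (𝓝[>] 0) (𝓝 0) := by
    simpa only [Real.sqrt_zero] using (Real.continuous_sqrt.tendsto 0).mono_left nhdsWithin_le_nhds
  have herror : Tendsto (fun ε : ℝ => √ε * C + (√ε + ε) * n) (𝓝[>] 0) (𝓝 0) := by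
    simpa only [zero_mul, add_zero] using
      (hsqrt.mul_const C).add ((hsqrt.add hid).mul_const (n : ℝ))
  have hdiff : Tendsto (fun ε => 2 * ε / n * m ε - ((2 * n - 1) / (n : ℝ) ^ 2 * v ε + ε ^ 2))
      (𝓝[>] 0) (𝓝 0) := by
    refine squeeze_zero_norm' ?_ herror
    filter_upwards [Ioc_mem_nhdsGT hε₀] with ε ⟨hε, hle⟩
    refine (hm ε hε hle).trans_eq ?_
    rw [← mul_assoc, add_mul, one_mul, one_div_mul_eq_div, Real.div_sqrt]
  have hnoise : Tendsto (fun ε => (2 * n - 1) / (n : ℝ) ^ 2 * v ε + ε ^ 2) (𝓝[>] 0)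
      (𝓝 ((2 * n - 1) / (n : ℝ) ^ 2 * s)) := by
    simpa only [zero_pow two_ne_zero, add_zero] using
      (hv.const_mul ((2 * n - 1) / (n : ℝ) ^ 2)).add (hid.pow 2)
  convert! (hdiff.add hnoise).const_mul ((n : ℝ) / 2) using 2
  · field_simp
    ring
  · field_simp
    ring

section Family

variable {n : ℕ} {S : ℝ → SwitchSystem.{u, v} n} {ν : Matrix (Fin n) (Fin n) ℝ}
  {σt : Fin n → Fin n → ℝ} {aMax : ℕ}

theorem HeavyTraffic.loadAssumption (hheavy : HeavyTraffic S ν σt) {ε : ℝ}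
    (hε : ε ∈ Set.Ioo (0 : ℝ) 1) (harr : (S ε).SlotArrivalAssumption aMax) :
    (S ε).LoadAssumption aMax ν ε where
  toSlotArrivalAssumption := harr
  unitSums := unitSums_of_mem_doublyStochastic hheavy.doublyStoch
  rate_eq := hheavy.rate_eq ε hε

theorem HeavyTraffic.tendsto_sum_arrivalVar (hheavy : HeavyTraffic S ν σt) :
    Tendsto (fun ε => ∑ i, ∑ j, (S ε).arrivalVar i j) (𝓝[>] 0) (𝓝 (‖vec σt‖ ^ 2)) := by
  rw [norm_sq_eq_sum]
  exact tendsto_finsetSum _ fun i _ => tendsto_finsetSum _ fun j _ => hheavy.tendsto_var i j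

variable (harr : ∀ ε ∈ Set.Ioo (0 : ℝ) 1, (S ε).SlotArrivalAssumption aMax)
  (hheavy : HeavyTraffic S ν σt) (hclass : InClassOne S ν)

include harr hheavy hclass

theorem stable_and_exists_isLimitLaw {ε : ℝ} (hε : ε ∈ Set.Ioo (0 : ℝ) 1) :
    (S ε).Stable ∧ ∃ π, IsLimitLaw (S ε).P π ∧
      ∀ r : ℕ, Integrable (fun y => ‖natVec ((S ε).g y)‖ ^ r) π.toMeasure := by
  obtain ⟨hA, W, hW₀, hW⟩ := hclass
  obtain ⟨hA₁, hA₂⟩ := hA ε hε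
  have hload := hheavy.loadAssumption hε (harr ε hε)
  exact ⟨hload.stable hA₁ hA₂ hheavy.pos hε.1 hW₀.le (hW ε hε),
    hload.exists_isLimitLaw hA₁ hA₂ hheavy.pos hε.1 hW₀.le (hW ε hε)⟩

theorem exists_uniform_integral_norm_perpK_pow_le : ∃ ε₀ : ℝ, 0 < ε₀ ∧ ε₀ < 1 ∧
    ∃ C : ℕ → ℝ, ∀ ε ∈ Set.Ioo (0 : ℝ) 1, ε ≤ ε₀ → ∀ π : PMF (S ε).A,
      IsLimitLaw (S ε).P π → ∀ r : ℕ,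
        ∫ y, ‖perpK (natVec ((S ε).g y))‖ ^ r ∂π.toMeasure ≤ C r := by
  obtain ⟨hA, W, hW₀, hW⟩ := hclass
  obtain ⟨C, hC⟩ := SwitchSystem.exists_integral_norm_perpK_pow_le.{u, v} n aMax hW₀
  obtain ⟨ε₁, hε₁, hsmall⟩ := exists_pos_mul_lt (half_pos hW₀) ‖vec ν‖
  refine ⟨min ε₁ (1 / 2), by positivity, (min_le_right _ _).trans_lt one_half_lt_one, C,
    fun ε hε hle => hC (S ε) ν ε (hheavy.loadAssumption hε (harr ε hε)) (hA ε hε).1 (hA ε hε).2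
      hε.1.le ?_ (hW ε hε)⟩
  calc ε * ‖vec ν‖ ≤ ε₁ * ‖vec ν‖ := by gcongr; exact hle.trans (min_le_left _ _)
    _ ≤ W / 2 := by rw [mul_comm]; exact hsmall.le

theorem achievesSSC : AchievesSSC S := by
  obtain ⟨ε₀, hε₀, -, C, hC⟩ := exists_uniform_integral_norm_perpK_pow_le harr hheavy hclass
  refine ⟨fun ε hε => ⟨(stable_and_exists_isLimitLaw harr hheavy hclass hε).1, hclass.1 ε hε⟩,
    ε₀, hε₀, C, fun ε hε hle => ?_⟩
  obtain ⟨-, π, hπ, hmom⟩ := stable_and_exists_isLimitLaw harr hheavy hclass hε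
  refine ⟨(S ε).queueLaw π, SwitchSystem.isSteadyState_queueLaw (hclass.1 ε hε).2 hπ,
    fun r _ => ⟨SwitchSystem.integrable_queueLaw (SwitchSystem.integrable_norm_perpK_pow hmom r),
      ?_⟩⟩
  rw [SwitchSystem.integral_queueLaw π fun M => ‖perpK (natVec M)‖ ^ r]
  exact hC ε hε hle π hπ r

theorem maxWeightLike (hn : 0 < n) : MaxWeightLike S σt := by
  obtain ⟨ε₀, hε₀, hε₀_lt, C, hC⟩ :=
    exists_uniform_integral_norm_perpK_pow_le harr hheavy hclass
  have (ε : ℝ) : Nonempty (PMF (S ε).A) := ⟨(S ε).initDist⟩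
  choose! π hπ hmom using fun ε hε => (stable_and_exists_isLimitLaw harr hheavy hclass
    (ε := ε) hε).2
  refine ⟨fun ε => (S ε).queueLaw (π ε), fun ε hε =>
    ⟨SwitchSystem.isSteadyState_queueLaw (hclass.1 ε hε).2 (hπ ε hε),
      SwitchSystem.integrable_queueLaw (SwitchSystem.integrable_total (hmom ε hε))⟩, ?_⟩
  refine tendsto_mul_of_abs_sub_le hn hε₀ (C := C 2) hheavy.tendsto_sum_arrivalVar
    fun ε hε₁ hle => ?_
  have hε : ε ∈ Set.Ioo (0 : ℝ) 1 := ⟨hε₁, hle.trans_lt hε₀_lt⟩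
  have hload := hheavy.loadAssumption hε (harr ε hε)
  rw [SwitchSystem.integral_queueLaw (π ε) fun M : NMat n => ∑ i, ∑ j, (M i j : ℝ)]
  refine (hload.abs_integral_total_sub_arrivalNoise_le (hmom ε hε) hn (hclass.1 ε hε).1
    (hclass.1 ε hε).2 (Real.sqrt_pos.2 hε₁) (hπ ε hε).bind_eq).trans ?_
  gcongr
  exact hC ε hε hle (π ε) (hπ ε hε) 2

end Family

end Switch

end

theorem mainTheorem1_general {n : ℕ} (hn : 0 < n)
    (S : ℝ → Switch.SwitchSystem.{u, v} n) (ν : Matrix (Fin n) (Fin n) ℝ)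
    (σt : Fin n → Fin n → ℝ) (aMax : ℕ)
    (harr : ∀ ε ∈ Set.Ioo (0 : ℝ) 1, (S ε).SlotArrivalAssumption aMax)
    (hheavy : Switch.HeavyTraffic S ν σt)
    (hclass : Switch.InClassOne S ν) :
    Switch.AchievesSSC S ∧ Switch.MaxWeightLike S σt :=
  ⟨Switch.achievesSSC harr hheavy hclass, Switch.maxWeightLike harr hheavy hclass hn⟩

theorem mainTheorem1 {n : ℕ} (hn : 0 < n)
    (S : ℝ → Switch.SwitchSystem.{u, v} n) (ν : Matrix (Fin n) (Fin n) ℝ)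
    (σt : Fin n → Fin n → ℝ) (aMax : ℕ)
    (harr : ∀ ε ∈ Set.Ioo (0 : ℝ) 1, (S ε).ArrivalAssumption aMax)
    (hheavy : Switch.HeavyTraffic S ν σt)
    (hclass : Switch.InClassOne S ν) :
    Switch.AchievesSSC S ∧ Switch.MaxWeightLike S σt :=
  mainTheorem1_general hn S ν σt aMax (fun ε hε => (harr ε hε).slotArrivalAssumption) hheavy hclass
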